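/- **Proposition (soliton equations for self-similar mean curvature flows).** Let $M^m$ and $(\bar M^{n+1},\bar g=\langle\cdot,\cdot\rangle)$ be smooth Riemannian manifolds (Hausdorff, second countable, without boundary), let $\bar\nabla$ be the Levi-Civita connection of $\bar M$, let $X$ be a smooth vector field on $\bar M$ with (possibly only local) flow $\Phi$, and let $(\omega_*,\omega^*)\ni 0$ be an open interval. Let $\Psi:(\omega_*,\omega^*)\times M\to\bar M$ be a mean curvature flow: a smooth map such that every $\Psi_\tau=\Psi(\tau,\cdot)$ is an immersion and $\partial\Psi/\partial\tau=\mathbf H$, where $\mathbf H=\sum_{i=1}^m II(e_i,e_i)$ is the non-normalized mean curvature vector of $\Psi_\tau$. Here $II(U,V)=(\bar\nabla_{\Psi_{\tau*}U}\Psi_{\tau*}V)^\perp$ is the second fundamental form of $\Psi_\tau$, the frame $e_1,\dots,e_m$ is orthonormal for the induced metric $g=\Psi_\tau^*\bar g$, and $\top$, $\perp$ denote the tangential and normal projections along $\Psi_\tau$. Suppose that $\Psi$ is self-similar with respect to $X$: there are an isometric immersion $\psi:M\to\bar M$ and a smooth function $\sigma$ on $(\omega_*,\omega^*)$ such that, for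 all $\tau\in(\omega_*,\omega^*)$, $\Phi_{\sigma(\tau)}$ is defined on $\psi(M)$ and $$\Psi_\tau(M)=\Phi_{\sigma(\tau)}(\psi(M)).$$ Then for every $\tau\in(\omega_*,\omega^*)$ there is a constant $c_\tau\in\mathbb R$ such that, with $T\in\Gamma(TM)$ the smooth vector field determined by $\Psi_{\tau*}T=X^\top$, $$c_\tau X=c_\tau\,\Psi_{\tau*}T+\mathbf H\qquad\text{along }\Psi_\tau.$$ Moreover, with the same constant $c_\tau$: 1. If $X$ is conformal, that is, $\mathcal L_X\bar g=2\bar\varphi\,\bar g$ with $\bar\varphi=\frac1{n+1}\operatorname{div}X$, then $$II_{-\mathbf H}+\frac{c_\tau}{2}\,\mathcal L_Tg=c_\tau\,\varphi\,g,\qquad \varphi=\bar\varphi\circ\Psi_\tau,$$ where $II_{-\mathbf H}(U,V)=\langle II(U,V),-\mathbf H\rangle$. 2. If $X$ is conformal and closed (the $1$-form $\langle X,\cdot\rangle$ is closed), then $$\bar\nabla^\perp\mathbf H+c_\tau\,II(T,\cdot)=0,$$ where $\bar\nabla^\perp_U\mathbf H=(\bar\nabla_{\Psi_{\tau*}U}\mathbf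 H)^\perp$ is the normal connection. -/

import Mathlib

open Set Bundle
open scoped Manifold ContDiff

noncomputable section

namespace MCFSoliton

/-! Manifolds `M`, `N` are modelled on `EuclideanSpace ℝ (Fin m)`, `EuclideanSpace ℝ (Fin d)`
(smooth, without boundary). The Riemannian metric of `N` is Mathlib's `RiemannianBundle` structure
on its tangent bundle. -/

/-- Tangent spaces are finite-dimensional. -/
instance instFiniteDimensionalTangentSpace {d : ℕ} {N : Type*} [TopologicalSpace N]
    [ChartedSpace (EuclideanSpace ℝ (Fin d)) N] (q : N) :
    FiniteDimensional ℝ (TangentSpace (𝓡 d) q) :=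
  inferInstanceAs (FiniteDimensional ℝ (EuclideanSpace ℝ (Fin d)))

/-! ### The Levi-Civita connection, also along maps -/

section Ambient

variable {d : ℕ} {N : Type*} [TopologicalSpace N] [ChartedSpace (EuclideanSpace ℝ (Fin d)) N]
  [IsManifold (𝓡 d) ∞ N] [RiemannianBundle (fun q : N => TangentSpace (𝓡 d) q)]

/-- The vector field near `q` with value `a` at `q` and constant components in the preferred chart
at `q` (Mathlib's `FiberBundle.extend`). Two such fields commute near `q`. -/
abbrev extendVector {q : N} (a : TangentSpace (𝓡 d) q) (p : N) : TangentSpace (𝓡 d) p :=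
  FiberBundle.extend (EuclideanSpace ℝ (Fin d)) a p

/-- The Christoffel term `Γ_q(a, b)` of the metric, in the preferred chart at `q`: with
`A, B, C` the coordinate-constant extensions of `a, b, c`,
`⟨Γ_q(a, b), c⟩ = (a⟨B, C⟩ + b⟨A, C⟩ - c⟨A, B⟩) / 2`.
The vector is recovered from these products by means of an orthonormal basis of `T_q N`. -/
def christoffel (q : N) (a b : TangentSpace (𝓡 d) q) : TangentSpace (𝓡 d) q :=
  ∑ k, ((1 / 2 : ℝ) *
    (mvfderiv (𝓡 d) (fun p => inner ℝ (extendVector b p)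
        (extendVector (stdOrthonormalBasis ℝ (TangentSpace (𝓡 d) q) k) p)) q a
      + mvfderiv (𝓡 d) (fun p => inner ℝ (extendVector a p)
        (extendVector (stdOrthonormalBasis ℝ (TangentSpace (𝓡 d) q) k) p)) q b
      - mvfderiv (𝓡 d) (fun p => inner ℝ (extendVector a p) (extendVector b p)) q
        (stdOrthonormalBasis ℝ (TangentSpace (𝓡 d) q) k))) •
    stdOrthonormalBasis ℝ (TangentSpace (𝓡 d) q) k

variable {m : ℕ} {M : Type*} [TopologicalSpace M] [ChartedSpace (EuclideanSpace ℝ (Fin m)) M]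
  [IsManifold (𝓡 m) ∞ M]

/-- The covariant derivative `(∇̄_u V)(x)` of a vector field `V` along a map `f : M → N`
(pull-back of the Levi-Civita connection of `N`): in the preferred chart at `f x`, its components
are `dVᵏ(u) + Γᵏᵢⱼ(f x) (df u)ⁱ Vʲ(x)`. -/
def covDerivAlong (f : M → N) (V : (x : M) → TangentSpace (𝓡 d) (f x)) (x : M)
    (u : TangentSpace (𝓡 m) x) : TangentSpace (𝓡 d) (f x) :=
  (trivializationAt (EuclideanSpace ℝ (Fin d)) (TangentSpace (𝓡 d) : N → Type _) (f x)).symm (f x)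
      (mvfderiv (𝓡 m) (fun y => (trivializationAt (EuclideanSpace ℝ (Fin d))
        (TangentSpace (𝓡 d) : N → Type _) (f x) ⟨f y, V y⟩).2) x u)
    + christoffel (f x) (mfderiv (𝓡 m) (𝓡 d) f x u) (V x)

/-- The Levi-Civita covariant derivative `∇̄_u X` of a vector field on `N`. -/
def leviCivita (X : (q : N) → TangentSpace (𝓡 d) q) (q : N) (u : TangentSpace (𝓡 d) q) :
    TangentSpace (𝓡 d) q :=
  covDerivAlong (id : N → N) X q u

/-- The divergence `div X = ∑ₖ ⟨∇̄_{eₖ} X, eₖ⟩`. -/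
def divergence (X : (q : N) → TangentSpace (𝓡 d) q) (q : N) : ℝ :=
  ∑ k, inner ℝ (leviCivita X q (stdOrthonormalBasis ℝ (TangentSpace (𝓡 d) q) k))
    (stdOrthonormalBasis ℝ (TangentSpace (𝓡 d) q) k)

/-- The conformal factor `φ̄ = div X / dim N`. -/
def conformalFactor (X : (q : N) → TangentSpace (𝓡 d) q) (q : N) : ℝ :=
  divergence X q / d

end Ambient

/-! ### Lie derivative of a metric, conformal and closed vector fields -/

section LieDerivative

variable {m : ℕ} {M : Type*} [TopologicalSpace M] [ChartedSpace (EuclideanSpace ℝ (Fin m)) M]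
  [IsManifold (𝓡 m) ∞ M]

/-- The Lie derivative of a `2`-tensor `g`:
`(𝓛_T g)(U, V) = T(g(U, V)) - g([T, U], V) - g(U, [T, V])`, evaluated at `x` on the vectors `u, v`
by means of vector fields `U, V` extending them (the right-hand side is tensorial). -/
def lieDerivTensor (g : (x : M) → TangentSpace (𝓡 m) x → TangentSpace (𝓡 m) x → ℝ)
    (T : (x : M) → TangentSpace (𝓡 m) x) (x : M) (u v : TangentSpace (𝓡 m) x) : ℝ :=
  mvfderiv (𝓡 m) (fun y => g y (extendVector u y) (extendVector v y)) x (T x)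
    - g x (VectorField.mlieBracket (𝓡 m) T (extendVector u) x) v
    - g x u (VectorField.mlieBracket (𝓡 m) T (extendVector v) x)

variable {d : ℕ} {N : Type*} [TopologicalSpace N] [ChartedSpace (EuclideanSpace ℝ (Fin d)) N]
  [IsManifold (𝓡 d) ∞ N] [RiemannianBundle (fun q : N => TangentSpace (𝓡 d) q)]

/-- `X` is conformal: `𝓛_X ḡ = 2 φ̄ ḡ` with `φ̄ = div X / dim N`. -/
def IsConformalField (X : (q : N) → TangentSpace (𝓡 d) q) : Prop :=
  ∀ (q : N) (u v : TangentSpace (𝓡 d) q),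
    lieDerivTensor (fun _ a b => inner ℝ a b) X q u v = 2 * conformalFactor X q * inner ℝ u v

/-- `X` is closed: the metrically equivalent `1`-form `ξ = ⟨X, ·⟩` is closed, where
`dξ(U, V) = U(ξ(V)) - V(ξ(U)) - ξ([U, V])`. -/
def IsClosedField (X : (q : N) → TangentSpace (𝓡 d) q) : Prop :=
  ∀ (q : N) (u v : TangentSpace (𝓡 d) q),
    mvfderiv (𝓡 d) (fun p => inner ℝ (X p) (extendVector v p)) q u
      - mvfderiv (𝓡 d) (fun p => inner ℝ (X p) (extendVector u p)) q v
      - inner ℝ (X q) (VectorField.mlieBracket (𝓡 d) (extendVector u) (extendVector v) q) = 0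

end LieDerivative

/-! ### Extrinsic geometry of an immersion -/

section Immersion

variable (m d : ℕ) {M N : Type*}
  [TopologicalSpace M] [ChartedSpace (EuclideanSpace ℝ (Fin m)) M] [IsManifold (𝓡 m) ∞ M]
  [TopologicalSpace N] [ChartedSpace (EuclideanSpace ℝ (Fin d)) N] [IsManifold (𝓡 d) ∞ N]
  [RiemannianBundle (fun q : N => TangentSpace (𝓡 d) q)]

/-- The tangent space `f_*(T_x M) ⊆ T_{f x} N` of the immersed submanifold. -/
def tangentImage (f : M → N) (x : M) : Submodule ℝ (TangentSpace (𝓡 d) (f x)) :=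
  (mfderiv (𝓡 m) (𝓡 d) f x).toLinearMap.range

/-- The tangential component `w^⊤`. -/
def tangentialPart (f : M → N) (x : M) (w : TangentSpace (𝓡 d) (f x)) :
    TangentSpace (𝓡 d) (f x) :=
  (tangentImage m d f x).starProjection w

/-- The normal component `w^⊥`. -/
def normalPart (f : M → N) (x : M) (w : TangentSpace (𝓡 d) (f x)) :
    TangentSpace (𝓡 d) (f x) :=
  w - tangentialPart m d f x w

/-- The metric induced on `M` by `f`. -/
def inducedMetric (f : M → N) (x : M) (u v : TangentSpace (𝓡 m) x) : ℝ :=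
  inner ℝ (mfderiv (𝓡 m) (𝓡 d) f x u) (mfderiv (𝓡 m) (𝓡 d) f x v)

/-- The second fundamental form `II(u, v) = (∇̄_u f_*V)^⊥`, where `V` extends `v`
(the right-hand side does not depend on the extension). -/
def secondFundamentalForm (f : M → N) (x : M) (u v : TangentSpace (𝓡 m) x) :
    TangentSpace (𝓡 d) (f x) :=
  normalPart m d f x
    (covDerivAlong f (fun y => mfderiv (𝓡 m) (𝓡 d) f y (extendVector v y)) x u)

/-- The second fundamental form `II_ξ(u, v) = ⟨II(u, v), ξ⟩` in the direction of `ξ`. -/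
def secondFundamentalFormDir (f : M → N) (x : M) (ξ : TangentSpace (𝓡 d) (f x))
    (u v : TangentSpace (𝓡 m) x) : ℝ :=
  inner ℝ (secondFundamentalForm m d f x u v) ξ

/-- A basis of `T_x M` (for `f` an immersion) orthonormal for the metric induced by `f`: the
vectors mapped by `f_*` to an orthonormal basis of `f_*(T_x M)`. -/
def inducedFrame (f : M → N) (x : M) (i : Fin (Module.finrank ℝ (tangentImage m d f x))) :
    TangentSpace (𝓡 m) x :=
  (stdOrthonormalBasis ℝ (tangentImage m d f x) i).2.choose

/-- The non-normalized mean curvature vector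
`H = (∑ᵢ ∇̄_{f_* eᵢ} f_* eᵢ)^⊥ = ∑ᵢ II(eᵢ, eᵢ)`. -/
def meanCurvature (f : M → N) (x : M) : TangentSpace (𝓡 d) (f x) :=
  ∑ i, secondFundamentalForm m d f x (inducedFrame m d f x i) (inducedFrame m d f x i)

/-- The normal connection `∇̄^⊥_u ξ = (∇̄_u ξ)^⊥` applied to a field `ξ` along `f`. -/
def normalConnection (f : M → N) (ξ : (x : M) → TangentSpace (𝓡 d) (f x)) (x : M)
    (u : TangentSpace (𝓡 m) x) : TangentSpace (𝓡 d) (f x) :=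
  normalPart m d f x (covDerivAlong f ξ x u)

/-! ### Self-similar mean curvature flows -/

/-- `Ψ : J × M → N` is a mean curvature flow: a smooth map, each slice of which is an immersion,
with `∂Ψ/∂τ = H`. Values of `Ψ τ` for `τ ∉ J` are irrelevant. -/
structure IsMeanCurvatureFlow (J : Set ℝ) (Ψ : ℝ → M → N) : Prop where
  smooth : ContMDiffOn (𝓘(ℝ, ℝ).prod (𝓡 m)) (𝓡 d) ∞ (fun z : ℝ × M => Ψ z.1 z.2) (J ×ˢ univ)
  immersion : ∀ τ ∈ J, ∀ x, Function.Injective (mfderiv (𝓡 m) (𝓡 d) (Ψ τ) x)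
  evolution : ∀ τ ∈ J, ∀ x,
    mfderiv 𝓘(ℝ, ℝ) (𝓡 d) (fun t => Ψ t x) τ (1 : ℝ) = meanCurvature m d (Ψ τ) x

/-- `Φ_s(p) = q` for the (maximal, possibly local) flow `Φ` of the vector field `X`: the integral
curve of `X` that starts at `p` exists up to time `s` and is at `q` at that time. -/
def FlowsTo (X : (q : N) → TangentSpace (𝓡 d) q) (s : ℝ) (p q : N) : Prop :=
  ∃ (K : Set ℝ) (γ : ℝ → N), IsOpen K ∧ K.OrdConnected ∧ 0 ∈ K ∧ s ∈ K ∧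
    IsMIntegralCurveOn γ X K ∧ γ 0 = p ∧ γ s = q

/-- `f` is an isometric immersion of the Riemannian manifold `M` into `N`. -/
structure IsIsometricImmersion [RiemannianBundle (fun x : M => TangentSpace (𝓡 m) x)]
    (f : M → N) : Prop where
  smooth : ContMDiff (𝓡 m) (𝓡 d) ∞ f
  isometric : ∀ (x : M) (u v : TangentSpace (𝓡 m) x), inducedMetric m d f x u v = inner ℝ u v

/-- The family `Ψ` is self-similar with respect to `X`: for some isometric immersion `ψ : M → N`
and some smooth reparametrization `s = σ(τ)` of the flow lines of `X`, the flow map `Φ_{σ(τ)}` is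
defined on `ψ(M)` and `Ψ_τ(M) = Φ_{σ(τ)}(ψ(M))` for all `τ ∈ J`. -/
def IsSelfSimilar [RiemannianBundle (fun x : M => TangentSpace (𝓡 m) x)]
    (J : Set ℝ) (Ψ : ℝ → M → N) (X : (q : N) → TangentSpace (𝓡 d) q) : Prop :=
  ∃ (ψ : M → N) (σ : ℝ → ℝ), IsIsometricImmersion m d ψ ∧ ContDiffOn ℝ ∞ σ J ∧
    ∀ τ ∈ J, (∀ p ∈ range ψ, ∃ q, FlowsTo d X (σ τ) p q) ∧
      range (Ψ τ) = {q | ∃ p ∈ range ψ, FlowsTo d X (σ τ) p q}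

end Immersion

end MCFSoliton

end

/-! The proof has an analytic part, which produces the constant `c = σ'(τ)`, and a part that
differentiates the resulting soliton equation.

*The constant.* The image of `Ψ_t` is carried by the flow `Φ` of `X`, in time `σ(τ) - σ(t)`, into
the image of `Ψ_τ` (`IsSelfSimilar.exists_flowsTo`): both are images of `ψ(M)` under the flow. Hence
`F(t, y) = Φ_{σ(τ) - σ(t)}(Ψ_t(y))`, defined near `(τ, x)`, takes values in the image of `Ψ_τ`. Its
differential at `(τ, x)` is `(s, v) ↦ s (H - σ'(τ) X) + Ψ_{τ*} v`. If `H - σ'(τ) X` were not tangent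
to the immersion, this differential would be injective, and the image of `F` would have Hausdorff
dimension at least `m + 1` (`not_injective_of_dimH_lt`). But the image of `Ψ_τ` has dimension at
most `m`, because `M` is second countable (`dimH_chart_image_range_le`). So `H - c X` is tangent,
with the same `c` at all points (`mfderiv_sub_smul_mem_tangentImage`); since `H` is normal, it is
the normal part of `c X`. No injectivity of `Ψ_τ` is needed: its image may have self-intersections,
or even be dense. Differentiable dependence of the flow on the initial point is needed only at
time `0`, which is `exists_local_flow_hasStrictFDerivAt`.

*Differentiation.* The two remaining facts are statements about one immersion `f` with
`c X = c f_*T + H` (`SolitonEquation`). The covariant derivative `covDerivAlong` is computed in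
charts; it is shown to be metric (`mvfderiv_inner_along`) and torsion-free (`coordHessian_symm`),
which gives `𝓛_T g(u, v) = ⟨∇̄_u f_*T, f_*v⟩ + ⟨f_*u, ∇̄_v f_*T⟩` for the induced metric and, with
`f` the identity, the analogous formula for `𝓛_X ḡ`. The equation for conformal `X` is the
symmetrized tangential part of the derivative of the soliton equation
(`SolitonEquation.conformal`). The equation for closed conformal `X` is its normal part, since then
`∇̄_u X = φ̄ u` (`SolitonEquation.closed_conformal`). -/

noncomputable section

namespace MCFSoliton

open scoped Topology

set_option linter.unusedSectionVars false

/-! ### Tangent vectors in the preferred charts -/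

section
variable {m : ℕ} {M : Type*} [TopologicalSpace M] [ChartedSpace (EuclideanSpace ℝ (Fin m)) M]

lemma mvfderiv_eq_fderiv {F : Type*} [NormedAddCommGroup F] [NormedSpace ℝ F] {h : M → F} {x : M}
    (hh : MDifferentiableAt (𝓡 m) 𝓘(ℝ, F) h x) (u : TangentSpace (𝓡 m) x) :
    mvfderiv (𝓡 m) h x u =
      fderiv ℝ (h ∘ (extChartAt (𝓡 m) x).symm) (extChartAt (𝓡 m) x x) u := by
  rw [hh.mvfderiv]
  simp [fderivWithin_univ]
  rfl

lemma differentiableAt_comp_chart_symm {F : Type*} [NormedAddCommGroup F] [NormedSpace ℝ F]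
    {h : M → F} {x : M} (hh : MDifferentiableAt (𝓡 m) 𝓘(ℝ, F) h x) :
    DifferentiableAt ℝ (h ∘ (extChartAt (𝓡 m) x).symm) (extChartAt (𝓡 m) x x) := by
  have := hh.differentiableWithinAt_writtenInExtChartAt
  rw [ModelWithCorners.range_eq_univ, differentiableWithinAt_univ] at this
  exact this

variable [IsManifold (𝓡 m) ∞ M]

/-- The components, in the preferred chart at `p`, of a tangent vector at `q`, depending linearly
on the vector. -/
def coords (m : ℕ) {M : Type*} [TopologicalSpace M]
    [ChartedSpace (EuclideanSpace ℝ (Fin m)) M] [IsManifold (𝓡 m) ∞ M] (p q : M) :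
    TangentSpace (𝓡 m) q →L[ℝ] EuclideanSpace ℝ (Fin m) :=
  (tangentBundleCore (𝓡 m) M).coordChange (achart _ q) (achart _ p) q

lemma triv_eq_coords (p q : M) (u : TangentSpace (𝓡 m) q) :
    (trivializationAt (EuclideanSpace ℝ (Fin m)) (TangentSpace (𝓡 m) : M → Type _) p ⟨q, u⟩).2
      = coords m p q u := rfl

lemma coords_self (x : M) (u : TangentSpace (𝓡 m) x) : coords m x x u = u :=
  (tangentBundleCore (𝓡 m) M).coordChange_self (achart _ x) x (mem_achart_source _ x) u

lemma triv_symm_self (x : M) (u : TangentSpace (𝓡 m) x) :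
    (trivializationAt (EuclideanSpace ℝ (Fin m)) (TangentSpace (𝓡 m) : M → Type _) x).symm x u
      = u := by
  have h := FiberBundle.extend_apply_self (F := EuclideanSpace ℝ (Fin m))
    (E := (TangentSpace (𝓡 m) : M → Type _)) (x := x) u
  have h2 := congrArg ((trivializationAt (EuclideanSpace ℝ (Fin m))
    (TangentSpace (𝓡 m) : M → Type _) x).symm x) (coords_self x u)
  exact h2.symm.trans h

lemma coords_extendVector {p q : M} (a : TangentSpace (𝓡 m) p)
    (hq : q ∈ (chartAt (EuclideanSpace ℝ (Fin m)) p).source) :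
    coords m p q (extendVector a q) = a := by
  have h := (trivializationAt (EuclideanSpace ℝ (Fin m)) (TangentSpace (𝓡 m) : M → Type _)
      p).apply_mk_symm (b := q) hq (coords m p p a)
  exact (congrArg Prod.snd h).trans (coords_self p a)

lemma coords_eq_mfderiv {p q : M}
    (hq : q ∈ (chartAt (EuclideanSpace ℝ (Fin m)) p).source) :
    coords m p q = mfderiv (𝓡 m) 𝓘(ℝ, EuclideanSpace ℝ (Fin m)) (extChartAt (𝓡 m) p) q := by
  rw [← TangentBundle.continuousLinearMapAt_trivializationAt hq,
    TangentBundle.continuousLinearMapAt_trivializationAt_eq_core hq]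
  rfl

lemma coords_injective {p q : M}
    (hq : q ∈ (chartAt (EuclideanSpace ℝ (Fin m)) p).source) : Function.Injective (coords m p q) := by
  have h := (Trivialization.continuousLinearEquivAt ℝ (trivializationAt (EuclideanSpace ℝ (Fin m))
    (TangentSpace (𝓡 m) : M → Type _) p) q hq).injective
  intro a b hab
  apply h
  exact hab

lemma contMDiffAt_extendVector {p : M} (a : TangentSpace (𝓡 m) p) :
    ContMDiffAt (𝓡 m) (𝓡 m).tangent ∞ (fun q : M =>
        (⟨q, extendVector (d := m) (N := M) a q⟩ : TangentBundle (𝓡 m) M)) p := by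
  rw [contMDiffAt_section]
  refine (contMDiffAt_const (c := coords m p p a)).congr_of_eventuallyEq ?_
  filter_upwards [(chartAt (EuclideanSpace ℝ (Fin m)) p).open_source.mem_nhds
      (mem_chart_source _ p)] with q hq
  exact (coords_extendVector a hq).trans (coords_self p a).symm
end

section
variable {m : ℕ} {M : Type*} [TopologicalSpace M] [ChartedSpace (EuclideanSpace ℝ (Fin m)) M]
 [IsManifold (𝓡 m) ∞ M]
variable {d : ℕ} {N : Type*} [TopologicalSpace N] [ChartedSpace (EuclideanSpace ℝ (Fin d)) N]
 [IsManifold (𝓡 d) ∞ N]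

/-- The differential of `f`, applied to components in the preferred charts at `x` and `f x`, is the
Fréchet derivative of the representation of `f` in these charts. -/
lemma coords_mfderiv {f : M → N} {x y : M} (hy : y ∈ (chartAt (EuclideanSpace ℝ (Fin m)) x).source)
    (hfy : f y ∈ (chartAt (EuclideanSpace ℝ (Fin d)) (f x)).source)
    (hf : MDifferentiableAt (𝓡 m) (𝓡 d) f y) (w : TangentSpace (𝓡 m) y) :
    coords d (f x) (f y) (mfderiv (𝓡 m) (𝓡 d) f y w) =
      fderiv ℝ (extChartAt (𝓡 d) (f x) ∘ f ∘ (extChartAt (𝓡 m) x).symm) (extChartAt (𝓡 m) x y)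
        (coords m x y w) := by
  have hev : (extChartAt (𝓡 d) (f x) ∘ f ∘ (extChartAt (𝓡 m) x).symm) ∘ extChartAt (𝓡 m) x =ᶠ[𝓝 y]
      extChartAt (𝓡 d) (f x) ∘ f := by
    filter_upwards [(chartAt (EuclideanSpace ℝ (Fin m)) x).open_source.mem_nhds hy] with z hz
    simp [(chartAt (EuclideanSpace ℝ (Fin m)) x).left_inv hz]
  have h1 : MDifferentiableAt (𝓡 d) 𝓘(ℝ, EuclideanSpace ℝ (Fin d)) (extChartAt (𝓡 d) (f x)) (f y) :=
    mdifferentiableAt_extChartAt hfy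
  have h2 : MDifferentiableAt (𝓡 m) 𝓘(ℝ, EuclideanSpace ℝ (Fin m)) (extChartAt (𝓡 m) x) y :=
    mdifferentiableAt_extChartAt hy
  have hsymm : MDifferentiableAt 𝓘(ℝ, EuclideanSpace ℝ (Fin m)) (𝓡 m) (extChartAt (𝓡 m) x).symm
      (extChartAt (𝓡 m) x y) := by
    have := mdifferentiableOn_extChartAt_symm (I := 𝓡 m) (x := x) (extChartAt (𝓡 m) x y)
      ((extChartAt (𝓡 m) x).map_source (by simpa using hy))
    exact this.mdifferentiableAt ((isOpen_extChartAt_target x).mem_nhds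
      ((extChartAt (𝓡 m) x).map_source (by simpa using hy)))
  have hinv : (extChartAt (𝓡 m) x).symm (extChartAt (𝓡 m) x y) = y :=
    (extChartAt (𝓡 m) x).left_inv (by simpa using hy)
  have h3 : MDifferentiableAt 𝓘(ℝ, EuclideanSpace ℝ (Fin m)) 𝓘(ℝ, EuclideanSpace ℝ (Fin d))
      (extChartAt (𝓡 d) (f x) ∘ f ∘ (extChartAt (𝓡 m) x).symm) (extChartAt (𝓡 m) x y) := by
    refine MDifferentiableAt.comp_of_eq (y := f y) _ h1 ?_ (by simp only [Function.comp, hinv])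
    exact MDifferentiableAt.comp_of_eq (y := y) _ hf hsymm hinv
  have e1 := congrArg (fun L => L (mfderiv (𝓡 m) (𝓡 d) f y w)) (coords_eq_mfderiv hfy)
  have e2 := mfderiv_comp_apply y h1 hf w
  have e3 := congrArg (fun L => L w)
    (hev.mfderiv_eq (I := 𝓡 m) (I' := 𝓘(ℝ, EuclideanSpace ℝ (Fin d))))
  have e4 := mfderiv_comp_apply y h3 h2 w
  have e5 := congrArg (fun L => L w) (coords_eq_mfderiv hy)
  have e6 := congrArg (fun L => L (coords m x y w)) (mfderiv_eq_fderiv (𝕜 := ℝ)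
    (f := extChartAt (𝓡 d) (f x) ∘ f ∘ (extChartAt (𝓡 m) x).symm) (x := extChartAt (𝓡 m) x y))
  refine e1.trans (e2.symm.trans (e3.symm.trans (e4.trans ?_)))
  exact Eq.trans (congrArg _ e5.symm) e6

/-- The differential of `f`, read in the preferred charts at `x` and `f x`. -/
def coordDeriv (m d : ℕ) {M N : Type*} [TopologicalSpace M]
    [ChartedSpace (EuclideanSpace ℝ (Fin m)) M] [TopologicalSpace N]
    [ChartedSpace (EuclideanSpace ℝ (Fin d)) N] (f : M → N) (x y : M) :
    EuclideanSpace ℝ (Fin m) →L[ℝ] EuclideanSpace ℝ (Fin d) :=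
  fderiv ℝ (extChartAt (𝓡 d) (f x) ∘ f ∘ (extChartAt (𝓡 m) x).symm) (extChartAt (𝓡 m) x y)

lemma eventually_mem_chart_source (x : M) :
    ∀ᶠ y in 𝓝 x, y ∈ (chartAt (EuclideanSpace ℝ (Fin m)) x).source :=
  (chartAt (EuclideanSpace ℝ (Fin m)) x).open_source.mem_nhds (mem_chart_source _ x)

lemma eventually_comp_mem_chart_source {f : M → N} {x : M} (hf : ContinuousAt f x) :
    ∀ᶠ y in 𝓝 x, f y ∈ (chartAt (EuclideanSpace ℝ (Fin d)) (f x)).source :=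
  hf.eventually (eventually_mem_chart_source (f x))

lemma contDiffAt_chart_rep {f : M → N} {x : M} {n : ℕ∞ω} (hf : ContMDiffAt (𝓡 m) (𝓡 d) n f x) :
    ContDiffAt ℝ n (extChartAt (𝓡 d) (f x) ∘ f ∘ (extChartAt (𝓡 m) x).symm)
      (extChartAt (𝓡 m) x x) := by
  have := (contMDiffAt_iff.1 hf).2
  rwa [ModelWithCorners.range_eq_univ, contDiffWithinAt_univ] at this

lemma eventually_coords_mfderiv {f : M → N} {x : M} (hf : ContMDiffAt (𝓡 m) (𝓡 d) ∞ f x) :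
    ∀ᶠ y in 𝓝 x, ∀ w : TangentSpace (𝓡 m) y,
      coords d (f x) (f y) (mfderiv (𝓡 m) (𝓡 d) f y w) = coordDeriv m d f x y (coords m x y w) := by
  have h1 : ∀ᶠ y in 𝓝 x, ContMDiffAt (𝓡 m) (𝓡 d) 1 f y :=
    (contMDiffAt_iff_contMDiffAt_nhds (by simp)).1 (hf.of_le (by simp))
  filter_upwards [eventually_mem_chart_source (m := m) x, eventually_comp_mem_chart_source (d := d)
      hf.continuousAt, h1]
    with y h1 h2 h3 w
  exact coords_mfderiv h1 h2 (h3.mdifferentiableAt one_ne_zero) w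

lemma coordDeriv_self {f : M → N} {x : M} (hf : ContMDiffAt (𝓡 m) (𝓡 d) ∞ f x)
    (w : TangentSpace (𝓡 m) x) : coordDeriv m d f x x w = mfderiv (𝓡 m) (𝓡 d) f x w := by
  have := (eventually_coords_mfderiv hf).self_of_nhds w
  rw [coords_self] at this
  exact ((congrArg (coordDeriv m d f x x) (coords_self x w)).symm.trans this.symm)

lemma contMDiffAt_coordDeriv {f : M → N} {x : M} (hf : ContMDiffAt (𝓡 m) (𝓡 d) ∞ f x) :
    ContMDiffAt (𝓡 m) 𝓘(ℝ, EuclideanSpace ℝ (Fin m) →L[ℝ] EuclideanSpace ℝ (Fin d)) ∞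
      (coordDeriv m d f x) x := by
  have h : ContDiffAt ℝ ∞ (fderiv ℝ (extChartAt (𝓡 d) (f x) ∘ f ∘ (extChartAt (𝓡 m) x).symm))
      (extChartAt (𝓡 m) x x) := (contDiffAt_chart_rep hf).fderiv_right (by simp)
  exact h.contMDiffAt.comp x (contMDiffAt_extChartAt)

/-- Symmetry of the second derivative in charts. -/
lemma mvfderiv_coordDeriv_symm {f : M → N} {x : M} (hf : ContMDiffAt (𝓡 m) (𝓡 d) ∞ f x)
    (u v : TangentSpace (𝓡 m) x) :
    mvfderiv (𝓡 m) (coordDeriv m d f x) x u v = mvfderiv (𝓡 m) (coordDeriv m d f x) x v u := by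
  have h2 := (contDiffAt_chart_rep hf).isSymmSndFDerivAt
    (by simpa using WithTop.coe_le_coe.2 (le_top (a := (2 : ℕ∞))))
  rw [mvfderiv_eq_fderiv ((contMDiffAt_coordDeriv hf).mdifferentiableAt (by simp)),
    mvfderiv_eq_fderiv ((contMDiffAt_coordDeriv hf).mdifferentiableAt (by simp))]
  have hev : coordDeriv m d f x ∘ (extChartAt (𝓡 m) x).symm =ᶠ[𝓝 (extChartAt (𝓡 m) x x)]
      fderiv ℝ (extChartAt (𝓡 d) (f x) ∘ f ∘ (extChartAt (𝓡 m) x).symm) := by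
    filter_upwards [(isOpen_extChartAt_target x).mem_nhds (mem_extChartAt_target x)] with z hz
    simp only [Function.comp, coordDeriv, (extChartAt (𝓡 m) x).right_inv hz]
  rw [hev.fderiv_eq]
  exact h2 u v

/-! ### The metric in a chart -/

section Metric
/-- The coordinate frame of the preferred chart at `p`. -/
def coordFrame (d : ℕ) {N : Type*} [TopologicalSpace N] [ChartedSpace (EuclideanSpace ℝ (Fin d)) N]
    [IsManifold (𝓡 d) ∞ N] (p : N) (i : Fin d) (q : N) : TangentSpace (𝓡 d) q :=
  extendVector (q := p) (EuclideanSpace.basisFun (Fin d) ℝ i) q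

lemma contMDiffAt_coordFrame (p : N) (i : Fin d) : ContMDiffAt (𝓡 d) (𝓡 d).tangent ∞
    (fun q : N => (⟨q, coordFrame d p i q⟩ : TangentBundle (𝓡 d) N)) p :=
  contMDiffAt_extendVector _

lemma coords_coordFrame {p q : N} (hq : q ∈ (chartAt (EuclideanSpace ℝ (Fin d)) p).source)
    (i : Fin d) : coords d p q (coordFrame d p i q) = EuclideanSpace.basisFun (Fin d) ℝ i :=
  coords_extendVector _ hq

variable [RiemannianBundle (fun q : N => TangentSpace (𝓡 d) q)]
  [IsContMDiffRiemannianBundle (𝓡 d) ∞ (EuclideanSpace ℝ (Fin d))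
      (fun q : N => TangentSpace (𝓡 d) q)]

/-- The metric coefficients in the preferred chart at `p`, as a bilinear form. -/
def metricCoeff (d : ℕ) {N : Type*} [TopologicalSpace N]
    [ChartedSpace (EuclideanSpace ℝ (Fin d)) N] [IsManifold (𝓡 d) ∞ N]
    [RiemannianBundle (fun q : N => TangentSpace (𝓡 d) q)] (p q : N) :
    EuclideanSpace ℝ (Fin d) →L[ℝ] EuclideanSpace ℝ (Fin d) →L[ℝ] ℝ :=
  ∑ i, ∑ j, (inner ℝ (coordFrame d p i q) (coordFrame d p j q) : ℝ) •
    ((EuclideanSpace.proj i : EuclideanSpace ℝ (Fin d) →L[ℝ] ℝ).smulRight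
      (EuclideanSpace.proj j : EuclideanSpace ℝ (Fin d) →L[ℝ] ℝ))

lemma inner_eq_metricCoeff {p q : N} (hq : q ∈ (chartAt (EuclideanSpace ℝ (Fin d)) p).source)
    (a b : TangentSpace (𝓡 d) q) :
    inner ℝ a b = metricCoeff d p q (coords d p q a) (coords d p q b) := by
  have key : ∀ a : TangentSpace (𝓡 d) q, a = ∑ i, (coords d p q a) i •
      coordFrame d p i q := by
    intro a
    apply coords_injective hq
    rw [map_sum]
    simp only [map_smul, coords_coordFrame hq]
    have := (EuclideanSpace.basisFun (Fin d) ℝ).sum_repr (coords d p q a)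
    exact this.symm
  conv_lhs => rw [key a, key b]
  simp only [sum_inner, inner_sum, metricCoeff, _root_.sum_apply, real_inner_smul_left,
    real_inner_smul_right]
  rw [Finset.sum_comm]
  refine Finset.sum_congr rfl fun i _ => Finset.sum_congr rfl fun j _ => ?_
  simp
  ring

lemma contMDiffAt_metricCoeff (p : N) :
    ContMDiffAt (𝓡 d) 𝓘(ℝ, EuclideanSpace ℝ (Fin d) →L[ℝ] EuclideanSpace ℝ (Fin d) →L[ℝ] ℝ) ∞
      (metricCoeff d p) p := by
  unfold metricCoeff
  refine contMDiffAt_finsetSum fun i _ => contMDiffAt_finsetSum fun j _ => ?_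
  have hi := contMDiffAt_coordFrame (d := d) p i
  have hj := contMDiffAt_coordFrame (d := d) p j
  have h := ContMDiffAt.inner_bundle (IB := 𝓡 d) (F := EuclideanSpace ℝ (Fin d)) (IM := 𝓡 d)
    (E := fun q : N => TangentSpace (𝓡 d) q) (b := fun q : N => q) hi hj
  exact h.smul contMDiffAt_const

end Metric
end

/-! ### Covariant derivatives along a map -/

section
variable {m : ℕ} {M : Type*} [TopologicalSpace M] [ChartedSpace (EuclideanSpace ℝ (Fin m)) M]
  [IsManifold (𝓡 m) ∞ M]
variable {d : ℕ} {N : Type*} [TopologicalSpace N] [ChartedSpace (EuclideanSpace ℝ (Fin d)) N]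
  [IsManifold (𝓡 d) ∞ N]

lemma mvfderiv_congr {F : Type*} [NormedAddCommGroup F] [NormedSpace ℝ F] {h h' : M → F} {x : M}
    (hh : h =ᶠ[𝓝 x] h') (u : TangentSpace (𝓡 m) x) :
    mvfderiv (𝓡 m) h x u = mvfderiv (𝓡 m) h' x u := by
  have := congrArg (fun L => L u) (hh.mfderiv_eq (I := 𝓡 m) (I' := 𝓘(ℝ, F)))
  exact this

lemma fderiv_bilin_apply {E F : Type*} [NormedAddCommGroup E] [NormedSpace ℝ E]
    [NormedAddCommGroup F] [NormedSpace ℝ F] {G : E → F →L[ℝ] F →L[ℝ] ℝ} {A B : E → F} {z : E}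
    (hG : DifferentiableAt ℝ G z) (hA : DifferentiableAt ℝ A z) (hB : DifferentiableAt ℝ B z)
    (u : E) :
    fderiv ℝ (fun y => G y (A y) (B y)) z u =
      fderiv ℝ G z u (A z) (B z) + G z (fderiv ℝ A z u) (B z) + G z (A z) (fderiv ℝ B z u) := by
  rw [((hG.hasFDerivAt.clm_apply hA.hasFDerivAt).clm_apply hB.hasFDerivAt).fderiv]
  simp only [_root_.add_apply, ContinuousLinearMap.comp_apply, ContinuousLinearMap.flip_apply]
  ring

lemma mvfderiv_bilin_apply {F : Type*} [NormedAddCommGroup F] [NormedSpace ℝ F]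
    {G : M → F →L[ℝ] F →L[ℝ] ℝ} {A B : M → F} {x : M}
    (hG : MDifferentiableAt (𝓡 m) 𝓘(ℝ, F →L[ℝ] F →L[ℝ] ℝ) G x)
    (hA : MDifferentiableAt (𝓡 m) 𝓘(ℝ, F) A x) (hB : MDifferentiableAt (𝓡 m) 𝓘(ℝ, F) B x)
    (u : TangentSpace (𝓡 m) x) :
    mvfderiv (𝓡 m) (fun y => G y (A y) (B y)) x u =
      mvfderiv (𝓡 m) G x u (A x) (B x) + G x (mvfderiv (𝓡 m) A x u) (B x)
        + G x (A x) (mvfderiv (𝓡 m) B x u) := by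
  rw [mvfderiv_eq_fderiv ((hG.clm_apply hA).clm_apply hB), mvfderiv_eq_fderiv hG,
    mvfderiv_eq_fderiv hA, mvfderiv_eq_fderiv hB]
  have := fderiv_bilin_apply (differentiableAt_comp_chart_symm hG)
    (differentiableAt_comp_chart_symm hA) (differentiableAt_comp_chart_symm hB) u
  simp only [Function.comp_apply, extChartAt_to_inv] at this
  exact this

lemma fderiv_clm_apply_vec {E F F' : Type*} [NormedAddCommGroup E] [NormedSpace ℝ E]
    [NormedAddCommGroup F] [NormedSpace ℝ F] [NormedAddCommGroup F'] [NormedSpace ℝ F']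
    {G : E → F →L[ℝ] F'} {A : E → F} {z : E}
    (hG : DifferentiableAt ℝ G z) (hA : DifferentiableAt ℝ A z) (u : E) :
    fderiv ℝ (fun y => G y (A y)) z u = fderiv ℝ G z u (A z) + G z (fderiv ℝ A z u) := by
  rw [(hG.hasFDerivAt.clm_apply hA.hasFDerivAt).fderiv]
  simp only [_root_.add_apply, ContinuousLinearMap.comp_apply, ContinuousLinearMap.flip_apply]
  exact add_comm _ _

lemma mvfderiv_clm_apply {F F' : Type*} [NormedAddCommGroup F] [NormedSpace ℝ F]
    [NormedAddCommGroup F'] [NormedSpace ℝ F']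
    {G : M → F →L[ℝ] F'} {A : M → F} {x : M}
    (hG : MDifferentiableAt (𝓡 m) 𝓘(ℝ, F →L[ℝ] F') G x)
    (hA : MDifferentiableAt (𝓡 m) 𝓘(ℝ, F) A x)
    (u : TangentSpace (𝓡 m) x) :
    mvfderiv (𝓡 m) (fun y => G y (A y)) x u =
      mvfderiv (𝓡 m) G x u (A x) + G x (mvfderiv (𝓡 m) A x u) := by
  rw [mvfderiv_eq_fderiv (hG.clm_apply hA), mvfderiv_eq_fderiv hG, mvfderiv_eq_fderiv hA]
  have := fderiv_clm_apply_vec (differentiableAt_comp_chart_symm hG)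
    (differentiableAt_comp_chart_symm hA) u
  simp only [Function.comp_apply, extChartAt_to_inv] at this
  exact this

lemma mvfderiv_const_apply {F : Type*} [NormedAddCommGroup F] [NormedSpace ℝ F] (c : F) (x : M)
    (u : TangentSpace (𝓡 m) x) : mvfderiv (𝓡 m) (fun _ : M => c) x u = 0 := by
  rw [mvfderiv_const]; rfl

/-- A vector field along `f` is differentiable at `x` if its components in the preferred chart
at `f x` are. -/
def DifferentiableAlong (m d : ℕ) {M N : Type*} [TopologicalSpace M]
    [ChartedSpace (EuclideanSpace ℝ (Fin m)) M] [TopologicalSpace N]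
    [ChartedSpace (EuclideanSpace ℝ (Fin d)) N] [IsManifold (𝓡 d) ∞ N]
    (f : M → N) (V : (x : M) → TangentSpace (𝓡 d) (f x)) (x : M) : Prop :=
  MDifferentiableAt (𝓡 m) 𝓘(ℝ, EuclideanSpace ℝ (Fin d)) (fun y => coords d (f x) (f y) (V y)) x

/-- A vector field on `M` is differentiable at `x` if its components in the preferred chart
at `x` are. -/
def DifferentiableField (m : ℕ) {M : Type*} [TopologicalSpace M]
    [ChartedSpace (EuclideanSpace ℝ (Fin m)) M] [IsManifold (𝓡 m) ∞ M]
    (T : (x : M) → TangentSpace (𝓡 m) x) (x : M) : Prop :=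
  MDifferentiableAt (𝓡 m) 𝓘(ℝ, EuclideanSpace ℝ (Fin m)) (fun y => coords m x y (T y)) x

/-- The derivative at `x` of the components of `T` in the preferred chart at `x`. -/
def coordFieldDeriv (m : ℕ) {M : Type*} [TopologicalSpace M]
    [ChartedSpace (EuclideanSpace ℝ (Fin m)) M] [IsManifold (𝓡 m) ∞ M]
    (T : (x : M) → TangentSpace (𝓡 m) x) (x : M) (u : TangentSpace (𝓡 m) x) :
    TangentSpace (𝓡 m) x :=
  mvfderiv (𝓡 m) (fun y => coords m x y (T y)) x u

lemma extendVector_self {x : M} (v : TangentSpace (𝓡 m) x) : extendVector v x = v :=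
  FiberBundle.extend_apply_self (F := EuclideanSpace ℝ (Fin m))
    (E := (TangentSpace (𝓡 m) : M → Type _)) v

lemma differentiableField_extendVector {x : M} (v : TangentSpace (𝓡 m) x) :
    DifferentiableField m (extendVector v) x := by
  refine (mdifferentiableAt_const (c := coords m x x v)).congr_of_eventuallyEq ?_
  filter_upwards [eventually_mem_chart_source (m := m) x] with y hy
  exact (coords_extendVector v hy).trans (coords_self x v).symm

lemma mvfderiv_coords_extendVector {x : M} (u v : TangentSpace (𝓡 m) x) :
    mvfderiv (𝓡 m) (fun y => coords m x y (extendVector v y)) x u = 0 := by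
  refine Eq.trans (mvfderiv_congr (h' := fun _ => coords m x x v) ?_ u) (mvfderiv_const_apply _ x u)
  filter_upwards [eventually_mem_chart_source (m := m) x] with y hy
  exact (coords_extendVector v hy).trans (coords_self x v).symm

lemma differentiableAlong_mfderiv {f : M → N} {x : M} (hf : ContMDiffAt (𝓡 m) (𝓡 d) ∞ f x)
    {T : (x : M) → TangentSpace (𝓡 m) x} (hT : DifferentiableField m T x) :
    DifferentiableAlong m d f (fun y => mfderiv (𝓡 m) (𝓡 d) f y (T y)) x := by
  have h := ((contMDiffAt_coordDeriv hf).mdifferentiableAt (by simp)).clm_apply hT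
  refine h.congr_of_eventuallyEq ?_
  filter_upwards [eventually_coords_mfderiv hf] with y hy
  exact hy _

lemma coords_covDerivAlong [RiemannianBundle (fun q : N => TangentSpace (𝓡 d) q)]
    (f : M → N) (V : (x : M) → TangentSpace (𝓡 d) (f x)) (x : M)
    (u : TangentSpace (𝓡 m) x) :
    coords d (f x) (f x) (covDerivAlong f V x u) =
      mvfderiv (𝓡 m) (fun y => coords d (f x) (f y) (V y)) x u
        + coords d (f x) (f x) (christoffel (f x) (mfderiv (𝓡 m) (𝓡 d) f x u) (V x)) := by
  unfold covDerivAlong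
  rw [map_add]
  congr 1
  refine (coords_self (f x) _).trans ?_
  exact triv_symm_self (f x) _

variable [RiemannianBundle (fun q : N => TangentSpace (𝓡 d) q)]
  [IsContMDiffRiemannianBundle (𝓡 d) ∞ (EuclideanSpace ℝ (Fin d))
      (fun q : N => TangentSpace (𝓡 d) q)]

/-- The derivative `a⟨B, C⟩` at `q` of the metric coefficients in the preferred chart at `q`, where
`B, C` are the coordinate-constant extensions of `b, c`. -/
def metricDeriv (q : N) (a b c : TangentSpace (𝓡 d) q) : ℝ :=
  mvfderiv (𝓡 d) (metricCoeff d q) q a (coords d q q b) (coords d q q c)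

lemma mvfderiv_inner_extendVector (q : N) (a b c : TangentSpace (𝓡 d) q) :
    mvfderiv (𝓡 d) (fun p => inner ℝ (extendVector b p) (extendVector c p)) q a
      = metricDeriv q a b c := by
  have hG := (contMDiffAt_metricCoeff (d := d) q).mdifferentiableAt (by simp)
  have hev : (fun p => (inner ℝ (extendVector b p) (extendVector c p) : ℝ)) =ᶠ[𝓝 q]
      fun p => metricCoeff d q p (coords d q q b) (coords d q q c) := by
    filter_upwards [eventually_mem_chart_source (m := d) q] with p hp
    rw [inner_eq_metricCoeff hp, coords_extendVector b hp, coords_extendVector c hp]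
    exact congrArg₂ (fun a b => metricCoeff d q p a b) (coords_self q b).symm (coords_self q c).symm
  rw [mvfderiv_congr hev, mvfderiv_bilin_apply hG mdifferentiableAt_const mdifferentiableAt_const,
    mvfderiv_const_apply, mvfderiv_const_apply, metricDeriv]
  simp only [map_zero, _root_.zero_apply, add_zero]

lemma metricDeriv_symm (q : N) (a b c : TangentSpace (𝓡 d) q) :
    metricDeriv q a b c = metricDeriv q a c b := by
  rw [← mvfderiv_inner_extendVector, ← mvfderiv_inner_extendVector]
  simp_rw [real_inner_comm]

/-- The Koszul formula for coordinate fields. It holds against all vectors because the right-hand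
side is linear in `c`. -/
lemma inner_christoffel (q : N) (a b c : TangentSpace (𝓡 d) q) :
    inner ℝ (christoffel q a b) c =
      (1 / 2 : ℝ) * (metricDeriv q a b c + metricDeriv q b a c - metricDeriv q c a b) := by
  have expand : ∀ l : TangentSpace (𝓡 d) q →ₗ[ℝ] ℝ, l c =
      ∑ k, inner ℝ (stdOrthonormalBasis ℝ (TangentSpace (𝓡 d) q) k) c *
        l (stdOrthonormalBasis ℝ (TangentSpace (𝓡 d) q) k) := by
    intro l
    conv_lhs => rw [← (stdOrthonormalBasis ℝ (TangentSpace (𝓡 d) q)).sum_repr' c]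
    simp only [map_sum, map_smul, smul_eq_mul]
  have hlin : IsLinearMap ℝ (fun c => (1 / 2 : ℝ) *
      (metricDeriv q a b c + metricDeriv q b a c - metricDeriv q c a b)) := by
    have hadd := fun x y => congrArg (fun L => L (coords d q q a) (coords d q q b))
      ((mvfderiv (𝓡 d) (metricCoeff d q) q).map_add x y)
    have hsmul := fun (r : ℝ) x => congrArg (fun L => L (coords d q q a) (coords d q q b))
      ((mvfderiv (𝓡 d) (metricCoeff d q) q).map_smul r x)
    constructor
    · intro x y
      have h3 : metricDeriv q (x + y) a b = metricDeriv q x a b + metricDeriv q y a b := hadd x y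
      rw [h3]
      simp only [metricDeriv, ContinuousLinearMap.map_add]
      ring
    · intro r x
      have h3 : metricDeriv q (r • x) a b = r * metricDeriv q x a b := hsmul r x
      rw [h3]
      simp only [metricDeriv, ContinuousLinearMap.map_smul, smul_eq_mul]
      ring
  have h := expand hlin.mk'
  refine Eq.trans ?_ h.symm
  unfold christoffel
  simp only [mvfderiv_inner_extendVector, sum_inner, real_inner_smul_left]
  refine Finset.sum_congr rfl fun k _ => ?_
  exact mul_comm _ _

lemma christoffel_symm (q : N) (a b : TangentSpace (𝓡 d) q) :
    christoffel q a b = christoffel q b a := by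
  apply ext_inner_right ℝ
  intro c
  rw [inner_christoffel, inner_christoffel, metricDeriv_symm q c a b]
  ring

/-- The infinitesimal form of metric compatibility. -/
lemma inner_christoffel_add (q : N) (a b c : TangentSpace (𝓡 d) q) :
    inner ℝ (christoffel q a b) c + inner ℝ b (christoffel q a c) = metricDeriv q a b c := by
  rw [real_inner_comm (christoffel q a c) b, inner_christoffel, inner_christoffel,
    metricDeriv_symm q a c b]
  ring

lemma christoffel_isLinearMap (q : N) (a : TangentSpace (𝓡 d) q) :
    IsLinearMap ℝ (christoffel q a) := by
  have hadd := fun c x y => congrArg (fun L => L (coords d q q a) (coords d q q c))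
    ((mvfderiv (𝓡 d) (metricCoeff d q) q).map_add x y)
  have hsmul := fun c (r : ℝ) x => congrArg (fun L => L (coords d q q a) (coords d q q c))
    ((mvfderiv (𝓡 d) (metricCoeff d q) q).map_smul r x)
  constructor
  · intro x y
    apply ext_inner_right ℝ
    intro c
    have h3 : metricDeriv q (x + y) a c = metricDeriv q x a c + metricDeriv q y a c := hadd c x y
    rw [inner_add_left, inner_christoffel, inner_christoffel, inner_christoffel, h3]
    simp only [metricDeriv, ContinuousLinearMap.map_add, _root_.add_apply]
    ring
  · intro r x
    apply ext_inner_right ℝ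
    intro c
    have h3 : metricDeriv q (r • x) a c = r * metricDeriv q x a c := hsmul c r x
    rw [real_inner_smul_left, inner_christoffel, inner_christoffel, h3]
    simp only [metricDeriv, ContinuousLinearMap.map_smul, _root_.smul_apply, smul_eq_mul]
    ring

/-- Metric compatibility of the Levi-Civita connection along a map. -/
lemma mvfderiv_inner_along {f : M → N} {V W : (x : M) → TangentSpace (𝓡 d) (f x)} {x : M}
    (hf : MDifferentiableAt (𝓡 m) (𝓡 d) f x)
    (hV : DifferentiableAlong m d f V x) (hW : DifferentiableAlong m d f W x)
    (u : TangentSpace (𝓡 m) x) :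
    mvfderiv (𝓡 m) (fun y => inner ℝ (V y) (W y)) x u =
      inner ℝ (covDerivAlong f V x u) (W x) + inner ℝ (V x) (covDerivAlong f W x u) := by
  have hG : MDifferentiableAt (𝓡 d) 𝓘(ℝ, EuclideanSpace ℝ (Fin d) →L[ℝ] EuclideanSpace ℝ
      (Fin d) →L[ℝ] ℝ)
    (metricCoeff d (f x)) (f x) := (contMDiffAt_metricCoeff (d := d) (f x)).mdifferentiableAt
        (by simp)
  have hGf : MDifferentiableAt (𝓡 m) 𝓘(ℝ, EuclideanSpace ℝ (Fin d) →L[ℝ] EuclideanSpace ℝ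
      (Fin d) →L[ℝ] ℝ)
      (fun y => metricCoeff d (f x) (f y)) x := hG.comp x hf
  have hcomp : mvfderiv (𝓡 m) (fun y => metricCoeff d (f x) (f y)) x u
      = mvfderiv (𝓡 d) (metricCoeff d (f x)) (f x) (mfderiv (𝓡 m) (𝓡 d) f x u) :=
    mfderiv_comp_apply x hG hf u
  have hev : (fun y => (inner ℝ (V y) (W y) : ℝ)) =ᶠ[𝓝 x] fun y => metricCoeff d (f x) (f y)
      (coords d (f x) (f y) (V y)) (coords d (f x) (f y) (W y)) := by
    filter_upwards [eventually_comp_mem_chart_source (d := d) hf.continuousAt] with y hy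
    exact inner_eq_metricCoeff hy _ _
  have hs := mem_chart_source (EuclideanSpace ℝ (Fin d)) (f x)
  rw [mvfderiv_congr hev, mvfderiv_bilin_apply hGf hV hW, hcomp, inner_eq_metricCoeff hs,
    inner_eq_metricCoeff hs, coords_covDerivAlong, coords_covDerivAlong]
  have key := inner_christoffel_add (f x) (mfderiv (𝓡 m) (𝓡 d) f x u) (V x) (W x)
  rw [inner_eq_metricCoeff hs, inner_eq_metricCoeff hs, metricDeriv] at key
  rw [← key]
  simp only [ContinuousLinearMap.map_add, _root_.add_apply]
  ring

/-- The Hessian `∇̄df(u, v)` of a map `f : M → N` with respect to the coordinate connection of the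
preferred chart of `M` at `x`: the covariant derivative of `f_*V` for the coordinate-constant
extension `V` of `v`. Its normal part is the second fundamental form. -/
def coordHessian (m d : ℕ) {M N : Type*} [TopologicalSpace M]
    [ChartedSpace (EuclideanSpace ℝ (Fin m)) M] [IsManifold (𝓡 m) ∞ M] [TopologicalSpace N]
    [ChartedSpace (EuclideanSpace ℝ (Fin d)) N] [IsManifold (𝓡 d) ∞ N]
    [RiemannianBundle (fun q : N => TangentSpace (𝓡 d) q)]
    (f : M → N) (x : M) (u v : TangentSpace (𝓡 m) x) : TangentSpace (𝓡 d) (f x) :=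
  covDerivAlong f (fun y => mfderiv (𝓡 m) (𝓡 d) f y (extendVector v y)) x u

lemma coords_covDerivAlong_mfderiv {f : M → N} {x : M} (hf : ContMDiffAt (𝓡 m) (𝓡 d) ∞ f x)
    {T : (x : M) → TangentSpace (𝓡 m) x} (hT : DifferentiableField m T x)
    (u : TangentSpace (𝓡 m) x) :
    coords d (f x) (f x) (covDerivAlong f (fun y => mfderiv (𝓡 m) (𝓡 d) f y (T y)) x u) =
      mvfderiv (𝓡 m) (coordDeriv m d f x) x u (coords m x x (T x)) +
        coordDeriv m d f x x (mvfderiv (𝓡 m) (fun y => coords m x y (T y)) x u) +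
        coords d (f x) (f x) (christoffel (f x) (mfderiv (𝓡 m) (𝓡 d) f x u)
          (mfderiv (𝓡 m) (𝓡 d) f x (T x))) := by
  rw [coords_covDerivAlong]
  congr 1
  have hT' : MDifferentiableAt (𝓡 m) 𝓘(ℝ, EuclideanSpace ℝ (Fin m))
    (fun y => coords m x y (T y)) x := hT
  rw [← mvfderiv_clm_apply ((contMDiffAt_coordDeriv hf).mdifferentiableAt (by simp)) hT']
  apply mvfderiv_congr
  filter_upwards [eventually_coords_mfderiv hf] with y hy
  exact hy _

/-- The connection is torsion-free along maps: second partial derivatives and Christoffel terms are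
symmetric. -/
lemma coordHessian_symm {f : M → N} {x : M} (hf : ContMDiffAt (𝓡 m) (𝓡 d) ∞ f x)
    (u v : TangentSpace (𝓡 m) x) : coordHessian m d f x u v = coordHessian m d f x v u := by
  apply coords_injective (mem_chart_source _ (f x))
  unfold coordHessian
  rw [coords_covDerivAlong_mfderiv hf (differentiableField_extendVector v),
    coords_covDerivAlong_mfderiv hf (differentiableField_extendVector u),
    mvfderiv_coords_extendVector, mvfderiv_coords_extendVector,
    extendVector_self, extendVector_self, christoffel_symm]
  congr 2
  have := mvfderiv_coordDeriv_symm hf u v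
  exact (congrArg _ (coords_self x v)).trans (this.trans (congrArg _ (coords_self x u)).symm)

/-- The covariant derivative of a tangential field `f_*T`. -/
lemma covDerivAlong_mfderiv {f : M → N} {x : M} (hf : ContMDiffAt (𝓡 m) (𝓡 d) ∞ f x)
    {T : (x : M) → TangentSpace (𝓡 m) x} (hT : DifferentiableField m T x)
    (u : TangentSpace (𝓡 m) x) :
    covDerivAlong f (fun y => mfderiv (𝓡 m) (𝓡 d) f y (T y)) x u =
      coordHessian m d f x u (T x) +
        mfderiv (𝓡 m) (𝓡 d) f x (coordFieldDeriv m T x u) := by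
  apply coords_injective (mem_chart_source _ (f x))
  rw [map_add, coordHessian, coords_covDerivAlong_mfderiv hf hT,
    coords_covDerivAlong_mfderiv hf (differentiableField_extendVector _),
    mvfderiv_coords_extendVector, extendVector_self, map_zero, add_zero]
  have h1 : coordDeriv m d f x x (mvfderiv (𝓡 m) (fun y => coords m x y (T y)) x u) =
      coords d (f x) (f x) (mfderiv (𝓡 m) (𝓡 d) f x (coordFieldDeriv m T x u)) :=
    (coordDeriv_self hf (coordFieldDeriv m T x u)).trans (coords_self (f x) _).symm
  rw [h1]
  abel

end

/-! ### Lie brackets and differentiability of fields -/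

section
variable {m : ℕ} {M : Type*} [TopologicalSpace M] [ChartedSpace (EuclideanSpace ℝ (Fin m)) M]
  [IsManifold (𝓡 m) ∞ M]
variable {d : ℕ} {N : Type*} [TopologicalSpace N] [ChartedSpace (EuclideanSpace ℝ (Fin d)) N]
  [IsManifold (𝓡 d) ∞ N]

lemma differentiableField_of_contMDiff {T : (x : M) → TangentSpace (𝓡 m) x} {x : M}
    (hT : ContMDiffAt (𝓡 m) (𝓡 m).tangent ∞ (fun x => (⟨x, T x⟩ : TangentBundle (𝓡 m) M)) x) :
    DifferentiableField m T x :=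
  ((contMDiffAt_section x).1 hT).mdifferentiableAt (by simp)

/-- Near the base point, the pull-back of a vector field by the inverse chart consists of its
components in the chart. -/
lemma mpullbackWithin_chart_symm (T : (x : M) → TangentSpace (𝓡 m) x) (x : M) :
    VectorField.mpullbackWithin 𝓘(ℝ, EuclideanSpace ℝ (Fin m)) (𝓡 m) (extChartAt (𝓡 m) x).symm T
        (range (𝓡 m)) =ᶠ[𝓝 (extChartAt (𝓡 m) x x)]
      (fun y => coords m x y (T y)) ∘ (extChartAt (𝓡 m) x).symm := by
  filter_upwards [(isOpen_extChartAt_target x).mem_nhds (mem_extChartAt_target x)] with z hz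
  have hy : (extChartAt (𝓡 m) x).symm z ∈ (chartAt (EuclideanSpace ℝ (Fin m)) x).source := by
    simpa using (extChartAt (𝓡 m) x).map_target hz
  have h1 := isInvertible_mfderivWithin_extChartAt_symm hz
  have h2 := mfderiv_extChartAt_comp_mfderivWithin_extChartAt_symm hz
  have h3 := congrArg (fun L => L (T ((extChartAt (𝓡 m) x).symm z))) (coords_eq_mfderiv hy)
  refine Eq.trans ?_ h3.symm
  rw [VectorField.mpullbackWithin_apply]
  obtain ⟨e, he⟩ := h1
  have h4 := congrArg (fun L => L (e.symm (T ((extChartAt (𝓡 m) x).symm z)))) h2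
  rw [← he] at h4 ⊢
  rw [ContinuousLinearMap.inverse_equiv]
  exact h4.symm.trans (congrArg (mfderiv (𝓡 m) 𝓘(ℝ, EuclideanSpace ℝ (Fin m)) (extChartAt (𝓡 m) x)
    ((extChartAt (𝓡 m) x).symm z)) (e.apply_symm_apply _))

/-- The bracket with the coordinate-constant extension of `u` is minus the derivative, in the
direction `u`, of the components. -/
lemma mlieBracket_extendVector {T : (x : M) → TangentSpace (𝓡 m) x} {x : M}
    (hT : DifferentiableField m T x) (u : TangentSpace (𝓡 m) x) :
    VectorField.mlieBracket (𝓡 m) T (extendVector u) x = - coordFieldDeriv m T x u := by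
  have hu := differentiableField_extendVector u
  have e1 := mpullbackWithin_chart_symm T x
  have e2 := mpullbackWithin_chart_symm (extendVector u) x
  rw [← VectorField.mlieBracketWithin_univ, VectorField.mlieBracketWithin_apply]
  have hinv : (mfderiv (𝓡 m) 𝓘(ℝ, EuclideanSpace ℝ (Fin m)) (extChartAt (𝓡 m) x) x).inverse =
      ContinuousLinearMap.id ℝ (TangentSpace (𝓡 m) x) := by
    have h1 : mfderiv (𝓡 m) 𝓘(ℝ, EuclideanSpace ℝ (Fin m)) (extChartAt (𝓡 m) x) x =
        ContinuousLinearMap.id ℝ (TangentSpace (𝓡 m) x) := by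
      refine (coords_eq_mfderiv (mem_chart_source _ x)).symm.trans ?_
      ext1 w
      exact coords_self x w
    exact (congrArg ContinuousLinearMap.inverse h1).trans ContinuousLinearMap.inverse_id
  have hid : ∀ z, (mfderiv (𝓡 m) 𝓘(ℝ, EuclideanSpace ℝ (Fin m)) (extChartAt (𝓡 m) x) x).inverse z =
      z :=
    fun z => congrArg (fun L => L z) hinv
  refine (hid _).trans ?_
  have hset : (extChartAt (𝓡 m) x).symm ⁻¹' univ ∩ range (𝓡 m) = univ := by simp
  rw [hset]
  refine (congrFun (VectorField.lieBracketWithin_univ (𝕜 := ℝ) (E := EuclideanSpace ℝ (Fin m)))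
    _).trans ?_
  refine (Filter.EventuallyEq.lieBracket_vectorField_eq (𝕜 := ℝ) (E := EuclideanSpace ℝ (Fin m))
    e1 e2).trans ?_
  have hT' : mvfderiv (𝓡 m) (fun y => coords m x y (T y)) x u = _ := mvfderiv_eq_fderiv hT u
  have hu' : mvfderiv (𝓡 m) (fun y => coords m x y (extendVector u y)) x (T x) = _ :=
    mvfderiv_eq_fderiv hu (T x)
  rw [mvfderiv_coords_extendVector] at hu'
  have e3 : ((fun y => coords m x y (T y)) ∘ (extChartAt (𝓡 m) x).symm) (extChartAt (𝓡 m) x x)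
      = T x :=
    (congrArg (fun y => coords m x y (T y)) (extChartAt_to_inv x)).trans (coords_self x (T x))
  have e4 : ((fun y => coords m x y (extendVector u y)) ∘ (extChartAt (𝓡 m) x).symm)
      (extChartAt (𝓡 m) x x) = u :=
    (congrArg (fun y => coords m x y (extendVector u y)) (extChartAt_to_inv x)).trans
      ((coords_self x _).trans (extendVector_self u))
  unfold VectorField.lieBracket coordFieldDeriv
  rw [hT', e3, e4, ← hu']
  exact zero_sub _

lemma mfderiv_id_apply (q : N) (a : TangentSpace (𝓡 d) q) :
    mfderiv (𝓡 d) (𝓡 d) (id : N → N) q a = a := by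
  rw [mfderiv_id]; rfl

lemma differentiableAlong_comp {f : M → N} {x : M} (hf : MDifferentiableAt (𝓡 m) (𝓡 d) f x)
    {X : (q : N) → TangentSpace (𝓡 d) q} (hX : DifferentiableField d X (f x)) :
    DifferentiableAlong m d f (fun y => X (f y)) x :=
  MDifferentiableAt.comp x hX hf

lemma DifferentiableAlong.sub {f : M → N} {x : M} {V W : (x : M) → TangentSpace (𝓡 d) (f x)}
    (hV : DifferentiableAlong m d f V x) (hW : DifferentiableAlong m d f W x) :
    DifferentiableAlong m d f (fun y => V y - W y) x := by
  have h := MDifferentiableAt.sub hV hW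
  refine h.congr_of_eventuallyEq (Filter.Eventually.of_forall fun y => ?_)
  exact (coords d (f x) (f y)).map_sub _ _

lemma DifferentiableAlong.const_smul {f : M → N} {x : M} {V : (x : M) → TangentSpace (𝓡 d) (f x)}
    (c : ℝ) (hV : DifferentiableAlong m d f V x) :
    DifferentiableAlong m d f (fun y => c • V y) x := by
  have h := MDifferentiableAt.const_smul hV c
  refine h.congr_of_eventuallyEq (Filter.Eventually.of_forall fun y => ?_)
  exact (coords d (f x) (f y)).map_smul _ _

/-! ### Tangential and normal parts -/

lemma tangentialPart_mfderiv [RiemannianBundle (fun q : N => TangentSpace (𝓡 d) q)]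
  (f : M → N) (x : M) (w : TangentSpace (𝓡 m) x) :
    tangentialPart m d f x (mfderiv (𝓡 m) (𝓡 d) f x w) = mfderiv (𝓡 m) (𝓡 d) f x w := by
  unfold tangentialPart
  rw [Submodule.starProjection_eq_self_iff]
  exact ⟨w, rfl⟩

lemma normalPart_mfderiv [RiemannianBundle (fun q : N => TangentSpace (𝓡 d) q)]
  (f : M → N) (x : M) (w : TangentSpace (𝓡 m) x) :
    normalPart m d f x (mfderiv (𝓡 m) (𝓡 d) f x w) = 0 := by
  rw [normalPart, tangentialPart_mfderiv, sub_self]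

variable [RiemannianBundle (fun q : N => TangentSpace (𝓡 d) q)]

lemma normalPart_add (f : M → N) (x : M) (a b : TangentSpace (𝓡 d) (f x)) :
    normalPart m d f x (a + b) = normalPart m d f x a + normalPart m d f x b := by
  simp only [normalPart, tangentialPart, map_add]
  abel

lemma normalPart_smul (f : M → N) (x : M) (c : ℝ) (a : TangentSpace (𝓡 d) (f x)) :
    normalPart m d f x (c • a) = c • normalPart m d f x a := by
  simp only [normalPart, tangentialPart, map_smul, smul_sub]

lemma inner_normalPart_mfderiv (f : M → N) (x : M) (a : TangentSpace (𝓡 d) (f x))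
    (w : TangentSpace (𝓡 m) x) :
    inner ℝ (normalPart m d f x a) (mfderiv (𝓡 m) (𝓡 d) f x w) = 0 := by
  have h := (tangentImage m d f x).starProjection_inner_eq_zero a (mfderiv (𝓡 m) (𝓡 d) f x w)
    ⟨w, rfl⟩
  exact h

lemma inner_normalPart_of_normal (f : M → N) (x : M) (a b : TangentSpace (𝓡 d) (f x))
    (hb : ∀ w : TangentSpace (𝓡 m) x, inner ℝ b (mfderiv (𝓡 m) (𝓡 d) f x w) = 0) :
    inner ℝ (normalPart m d f x a) b = inner ℝ a b := by
  obtain ⟨w, hw⟩ : tangentialPart m d f x a ∈ tangentImage m d f x :=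
    Submodule.starProjection_apply_mem _ _
  have h : inner ℝ (tangentialPart m d f x a) b = 0 := by
    rw [← hw, real_inner_comm]
    exact hb w
  rw [normalPart, inner_sub_left, h, sub_zero]

lemma inner_meanCurvature_mfderiv (f : M → N) (x : M) (w : TangentSpace (𝓡 m) x) :
    inner ℝ (meanCurvature m d f x) (mfderiv (𝓡 m) (𝓡 d) f x w) = 0 := by
  unfold meanCurvature secondFundamentalForm
  rw [sum_inner]
  exact Finset.sum_eq_zero fun i _ => inner_normalPart_mfderiv f x _ w

lemma normalPart_meanCurvature (f : M → N) (x : M) :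
    normalPart m d f x (meanCurvature m d f x) = meanCurvature m d f x := by
  obtain ⟨w, hw⟩ : tangentialPart m d f x (meanCurvature m d f x) ∈ tangentImage m d f x :=
    Submodule.starProjection_apply_mem _ _
  have h3 : tangentialPart m d f x (meanCurvature m d f x) = 0 := by
    have h4 := inner_normalPart_mfderiv (m := m) (d := d) f x (meanCurvature m d f x) w
    have h5 := inner_meanCurvature_mfderiv (m := m) (d := d) f x w
    have hw' : mfderiv (𝓡 m) (𝓡 d) f x w = tangentialPart m d f x (meanCurvature m d f x) := hw
    rw [normalPart, inner_sub_left, h5, hw', zero_sub, neg_eq_zero] at h4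
    exact inner_self_eq_zero.1 h4
  rw [normalPart, h3, sub_zero]

/-! ### Lie derivatives of metrics, closed and conformal fields -/

variable [IsContMDiffRiemannianBundle (𝓡 d) ∞ (EuclideanSpace ℝ (Fin d))
      (fun q : N => TangentSpace (𝓡 d) q)]

/-- The Lie derivative of the induced metric, in terms of the ambient connection: the Christoffel
terms of the two covariant derivatives combine with the brackets by symmetry of the Hessian. -/
lemma lieDerivTensor_inducedMetric {f : M → N} {x : M} (hf : ContMDiffAt (𝓡 m) (𝓡 d) ∞ f x)
    {T : (x : M) → TangentSpace (𝓡 m) x} (hT : DifferentiableField m T x)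
    (u v : TangentSpace (𝓡 m) x) :
    lieDerivTensor (inducedMetric m d f) T x u v =
      inner ℝ (covDerivAlong f (fun y => mfderiv (𝓡 m) (𝓡 d) f y (T y)) x u)
        (mfderiv (𝓡 m) (𝓡 d) f x v)
      + inner ℝ (mfderiv (𝓡 m) (𝓡 d) f x u)
        (covDerivAlong f (fun y => mfderiv (𝓡 m) (𝓡 d) f y (T y)) x v) := by
  unfold lieDerivTensor inducedMetric
  rw [mvfderiv_inner_along (hf.mdifferentiableAt (by simp))
    (differentiableAlong_mfderiv hf (differentiableField_extendVector u))
    (differentiableAlong_mfderiv hf (differentiableField_extendVector v)),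
    mlieBracket_extendVector hT, mlieBracket_extendVector hT, covDerivAlong_mfderiv hf hT,
    covDerivAlong_mfderiv hf hT, ← coordHessian, ← coordHessian, coordHessian_symm hf (T x) u,
    coordHessian_symm hf (T x) v, extendVector_self, extendVector_self]
  simp only [map_neg, inner_neg_left, inner_neg_right, inner_add_left, inner_add_right]
  ring

/-- The previous formula for the identity immersion. -/
lemma lieDerivTensor_inner {X : (q : N) → TangentSpace (𝓡 d) q} {q : N}
    (hX : DifferentiableField d X q) (u v : TangentSpace (𝓡 d) q) :
    lieDerivTensor (fun _ a b => inner ℝ a b) X q u v =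
      inner ℝ (leviCivita X q u) v + inner ℝ u (leviCivita X q v) := by
  have h := lieDerivTensor_inducedMetric (f := (id : N → N)) contMDiffAt_id hX u v
  have h1 : (inducedMetric d d (id : N → N)) = fun (q : N) (a b : TangentSpace (𝓡 d) q) => inner ℝ a
      b := by
    funext q a b
    unfold inducedMetric
    rw [mfderiv_id_apply, mfderiv_id_apply]
  have h2 : (fun y => mfderiv (𝓡 d) (𝓡 d) (id : N → N) y (X y)) = X := by
    funext y
    exact mfderiv_id_apply y (X y)
  rw [h1, mfderiv_id_apply, mfderiv_id_apply, h2] at h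
  exact h

lemma covDerivAlong_comp {f : M → N} {x : M} (hf : MDifferentiableAt (𝓡 m) (𝓡 d) f x)
    {X : (q : N) → TangentSpace (𝓡 d) q} (hX : DifferentiableField d X (f x))
    (u : TangentSpace (𝓡 m) x) :
    covDerivAlong f (fun y => X (f y)) x u = leviCivita X (f x) (mfderiv (𝓡 m) (𝓡 d) f x u) := by
  apply coords_injective (mem_chart_source _ (f x))
  unfold leviCivita
  rw [coords_covDerivAlong]
  refine Eq.trans ?_ (coords_covDerivAlong (id : N → N) X (f x) (mfderiv (𝓡 m) (𝓡 d) f x u)).symm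
  rw [mfderiv_id_apply]
  congr 1
  exact mfderiv_comp_apply x hX hf u

lemma covDerivAlong_sub {f : M → N} {x : M} {V W : (x : M) → TangentSpace (𝓡 d) (f x)}
    (hV : DifferentiableAlong m d f V x) (hW : DifferentiableAlong m d f W x)
    (u : TangentSpace (𝓡 m) x) :
    covDerivAlong f (fun y => V y - W y) x u = covDerivAlong f V x u - covDerivAlong f W x u := by
  apply coords_injective (mem_chart_source _ (f x))
  have hΓ : christoffel (f x) (mfderiv (𝓡 m) (𝓡 d) f x u) (V x - W x) =
      christoffel (f x) (mfderiv (𝓡 m) (𝓡 d) f x u) (V x)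
        - christoffel (f x) (mfderiv (𝓡 m) (𝓡 d) f x u) (W x) := by
    have h := (christoffel_isLinearMap (f x) (mfderiv (𝓡 m) (𝓡 d) f x u)).map_sub (V x) (W x)
    exact h
  rw [coords_covDerivAlong, map_sub, coords_covDerivAlong, coords_covDerivAlong, hΓ, map_sub]
  have h1 : mvfderiv (𝓡 m) (fun y => coords d (f x) (f y) (V y - W y)) x u =
      mvfderiv (𝓡 m) (fun y => coords d (f x) (f y) (V y)) x u
        - mvfderiv (𝓡 m) (fun y => coords d (f x) (f y) (W y)) x u := by
    have h := congrArg (fun L => L u) (mvfderiv_sub hV hW)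
    refine Eq.trans (mvfderiv_congr (Filter.Eventually.of_forall fun y => ?_) u) h
    exact (coords d (f x) (f y)).map_sub _ _
  rw [h1]
  abel

lemma covDerivAlong_const_smul {f : M → N} {x : M} {V : (x : M) → TangentSpace (𝓡 d) (f x)}
    (c : ℝ) (hV : DifferentiableAlong m d f V x) (u : TangentSpace (𝓡 m) x) :
    covDerivAlong f (fun y => c • V y) x u = c • covDerivAlong f V x u := by
  apply coords_injective (mem_chart_source _ (f x))
  have hΓ : christoffel (f x) (mfderiv (𝓡 m) (𝓡 d) f x u) (c • V x) =
      c • christoffel (f x) (mfderiv (𝓡 m) (𝓡 d) f x u) (V x) :=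
    (christoffel_isLinearMap (f x) (mfderiv (𝓡 m) (𝓡 d) f x u)).map_smul c (V x)
  rw [coords_covDerivAlong, map_smul, coords_covDerivAlong, hΓ, map_smul]
  have h1 : mvfderiv (𝓡 m) (fun y => coords d (f x) (f y) (c • V y)) x u =
      c • mvfderiv (𝓡 m) (fun y => coords d (f x) (f y) (V y)) x u := by
    have h := congrArg (fun L => L u) (const_smul_mfderiv hV c)
    refine Eq.trans (mvfderiv_congr (Filter.Eventually.of_forall fun y => ?_) u) h
    exact (coords d (f x) (f y)).map_smul _ _
  rw [h1, smul_add]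

/-- For a closed field the covariant derivative is self-adjoint. -/
lemma IsClosedField.inner_leviCivita {X : (q : N) → TangentSpace (𝓡 d) q} (hc : IsClosedField X)
    {q : N} (hX : DifferentiableField d X q) (u v : TangentSpace (𝓡 d) q) :
    inner ℝ (leviCivita X q u) v = inner ℝ u (leviCivita X q v) := by
  have hid : ContMDiffAt (𝓡 d) (𝓡 d) ∞ (id : N → N) q := contMDiffAt_id
  have key : ∀ u v : TangentSpace (𝓡 d) q,
      mvfderiv (𝓡 d) (fun p => inner ℝ (X p) (extendVector v p)) q u =
        inner ℝ (leviCivita X q u) v + inner ℝ (X q) (coordHessian d d (id : N → N) q u v) := by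
    intro u v
    have h := mvfderiv_inner_along (f := (id : N → N)) (V := X)
      (W := fun y => mfderiv (𝓡 d) (𝓡 d) (id : N → N) y (extendVector v y))
      (hid.mdifferentiableAt (by simp)) hX
      (differentiableAlong_mfderiv hid (differentiableField_extendVector v)) u
    have h2 : (fun y => mfderiv (𝓡 d) (𝓡 d) (id : N → N) y (extendVector v y))
        = fun y : N => extendVector v y := by
      funext y
      exact mfderiv_id_apply y _
    rw [← coordHessian, mfderiv_id_apply, extendVector_self] at h
    refine Eq.trans ?_ h
    apply mvfderiv_congr
    refine Filter.Eventually.of_forall fun y => ?_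
    exact congrArg (fun w => inner ℝ (X y) w) (mfderiv_id_apply y (extendVector v y)).symm
  have h := hc q u v
  have hbr : VectorField.mlieBracket (𝓡 d) (extendVector u) (extendVector v) q = 0 := by
    rw [mlieBracket_extendVector (differentiableField_extendVector u), coordFieldDeriv,
      mvfderiv_coords_extendVector]
    exact neg_zero
  rw [key, key, hbr, inner_zero_right, coordHessian_symm hid u v,
    real_inner_comm u (leviCivita X q v)] at h
  linarith

/-- A closed conformal field satisfies `∇̄_u X = φ̄ u`. -/
lemma leviCivita_of_closed_conformal {X : (q : N) → TangentSpace (𝓡 d) q} (hc : IsClosedField X)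
    (hconf : IsConformalField X) {q : N} (hX : DifferentiableField d X q)
    (u : TangentSpace (𝓡 d) q) : leviCivita X q u = conformalFactor X q • u := by
  apply ext_inner_right ℝ
  intro v
  have h1 := hconf q u v
  rw [lieDerivTensor_inner hX, ← hc.inner_leviCivita hX] at h1
  rw [real_inner_smul_left]
  linarith

end

/-! ### Consequences of the soliton equation -/

section
variable {m : ℕ} {M : Type*} [TopologicalSpace M] [ChartedSpace (EuclideanSpace ℝ (Fin m)) M]
  [IsManifold (𝓡 m) ∞ M]
variable {d : ℕ} {N : Type*} [TopologicalSpace N] [ChartedSpace (EuclideanSpace ℝ (Fin d)) N]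
  [IsManifold (𝓡 d) ∞ N]
  [RiemannianBundle (fun q : N => TangentSpace (𝓡 d) q)]
  [IsContMDiffRiemannianBundle (𝓡 d) ∞ (EuclideanSpace ℝ (Fin d))
      (fun q : N => TangentSpace (𝓡 d) q)]

/-- The second fundamental form may be computed with any extension of the vector `T x`. -/
lemma normalPart_covDerivAlong_mfderiv {f : M → N} {x : M} (hf : ContMDiffAt (𝓡 m) (𝓡 d) ∞ f x)
    {T : (x : M) → TangentSpace (𝓡 m) x} (hT : DifferentiableField m T x)
    (u : TangentSpace (𝓡 m) x) :
    normalPart m d f x (covDerivAlong f (fun y => mfderiv (𝓡 m) (𝓡 d) f y (T y)) x u) =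
      secondFundamentalForm m d f x (T x) u := by
  rw [covDerivAlong_mfderiv hf hT, normalPart_add, normalPart_mfderiv, add_zero,
    coordHessian_symm hf]
  rfl

/-- The Weingarten equation. -/
lemma inner_covDerivAlong_normal {f : M → N} {x : M} (hf : ContMDiffAt (𝓡 m) (𝓡 d) ∞ f x)
    {ν : (x : M) → TangentSpace (𝓡 d) (f x)} (hν : DifferentiableAlong m d f ν x)
    (hn : ∀ y, ∀ w : TangentSpace (𝓡 m) y, inner ℝ (ν y) (mfderiv (𝓡 m) (𝓡 d) f y w) = 0)
    (u v : TangentSpace (𝓡 m) x) :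
    inner ℝ (covDerivAlong f ν x u) (mfderiv (𝓡 m) (𝓡 d) f x v) =
      - secondFundamentalFormDir m d f x (ν x) u v := by
  have h := mvfderiv_inner_along (hf.mdifferentiableAt (by simp)) hν
    (differentiableAlong_mfderiv hf (differentiableField_extendVector v)) u
  simp only [hn] at h
  rw [mvfderiv_const_apply, extendVector_self] at h
  rw [secondFundamentalFormDir, secondFundamentalForm, inner_normalPart_of_normal f x _ _ (hn x),
    real_inner_comm (ν x)]
  linarith

/-- The soliton equation `c X = c f_*T + H` along an immersion `f`, together with the regularity of
`f`, `X` and `T`. -/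
structure SolitonEquation (m d : ℕ) {M N : Type*} [TopologicalSpace M]
    [ChartedSpace (EuclideanSpace ℝ (Fin m)) M] [IsManifold (𝓡 m) ∞ M] [TopologicalSpace N]
    [ChartedSpace (EuclideanSpace ℝ (Fin d)) N] [IsManifold (𝓡 d) ∞ N]
    [RiemannianBundle (fun q : N => TangentSpace (𝓡 d) q)] (f : M → N)
    (X : (q : N) → TangentSpace (𝓡 d) q) (T : (x : M) → TangentSpace (𝓡 m) x) (c : ℝ) : Prop where
  smooth : ContMDiff (𝓡 m) (𝓡 d) ∞ f
  diff_ambient : ∀ q, DifferentiableField d X q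
  diff_tangent : ∀ x, DifferentiableField m T x
  equation : ∀ x, c • X (f x) = c • mfderiv (𝓡 m) (𝓡 d) f x (T x) + meanCurvature m d f x

namespace SolitonEquation
variable {f : M → N} {X : (q : N) → TangentSpace (𝓡 d) q} {T : (x : M) → TangentSpace (𝓡 m) x}
  {c : ℝ}

lemma meanCurvature_eq (h : SolitonEquation m d f X T c) : meanCurvature m d f =
    fun x => c • X (f x) - c • mfderiv (𝓡 m) (𝓡 d) f x (T x) := by
  funext x
  rw [h.equation x]
  abel

lemma differentiableAlong_meanCurvature (h : SolitonEquation m d f X T c)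
    (x : M) :
    DifferentiableAlong m d f (meanCurvature m d f) x := by
  rw [h.meanCurvature_eq]
  exact ((differentiableAlong_comp ((h.smooth x).mdifferentiableAt (by simp))
      (h.diff_ambient _)).const_smul c).sub
    ((differentiableAlong_mfderiv (h.smooth x) (h.diff_tangent x)).const_smul c)

lemma covDerivAlong_meanCurvature (h : SolitonEquation m d f X T c) (x : M)
    (u : TangentSpace (𝓡 m) x) :
    covDerivAlong f (meanCurvature m d f) x u =
      c • leviCivita X (f x) (mfderiv (𝓡 m) (𝓡 d) f x u)
        - c • covDerivAlong f (fun y => mfderiv (𝓡 m) (𝓡 d) f y (T y)) x u := by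
  have h1 := differentiableAlong_comp ((h.smooth x).mdifferentiableAt (by simp))
      (h.diff_ambient (f x))
  have h2 := differentiableAlong_mfderiv (h.smooth x) (h.diff_tangent x)
  rw [h.meanCurvature_eq,
    covDerivAlong_sub (h1.const_smul c) (h2.const_smul c), covDerivAlong_const_smul c h1,
    covDerivAlong_const_smul c h2, covDerivAlong_comp ((h.smooth x).mdifferentiableAt (by simp))
        (h.diff_ambient _)]

/-- By the Weingarten equation, the derivative of `H = c X - c f_*T` paired with `f_*v` is
`-II_H(u, v)`. The sum of this identity with the one for `u, v` exchanged turns `∇̄X` and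
`∇̄(f_*T)` into half the Lie derivatives of the ambient and of the induced metric. -/
theorem conformal (h : SolitonEquation m d f X T c)
    (hconf : IsConformalField X) (x : M)
    (u v : TangentSpace (𝓡 m) x) :
    secondFundamentalFormDir m d f x (-meanCurvature m d f x) u v
        + c / 2 * lieDerivTensor (inducedMetric m d f) T x u v
      = c * conformalFactor X (f x) * inducedMetric m d f x u v := by
  have hH := h.differentiableAlong_meanCurvature x
  have hW := inner_covDerivAlong_normal (h.smooth x) hH (inner_meanCurvature_mfderiv f)
  have huv := hW u v
  have hvu := hW v u
  have hsymm : secondFundamentalFormDir m d f x (meanCurvature m d f x) v u =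
      secondFundamentalFormDir m d f x (meanCurvature m d f x) u v := by
    unfold secondFundamentalFormDir secondFundamentalForm
    rw [← coordHessian, ← coordHessian, coordHessian_symm (h.smooth x)]
  have hneg : secondFundamentalFormDir m d f x (-meanCurvature m d f x) u v =
      - secondFundamentalFormDir m d f x (meanCurvature m d f x) u v := inner_neg_right _ _
  have hc := hconf (f x) (mfderiv (𝓡 m) (𝓡 d) f x u) (mfderiv (𝓡 m) (𝓡 d) f x v)
  rw [lieDerivTensor_inner (h.diff_ambient _)] at hc
  rw [h.covDerivAlong_meanCurvature, inner_sub_left, real_inner_smul_left,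
    real_inner_smul_left] at huv hvu
  rw [hneg, lieDerivTensor_inducedMetric (h.smooth x) (h.diff_tangent x), inducedMetric]
  rw [hsymm] at hvu
  rw [real_inner_comm] at hvu
  rw [real_inner_comm (mfderiv (𝓡 m) (𝓡 d) f x u)] at hvu
  linear_combination (-1/2) * huv - (1/2) * hvu + (c / 2) * hc

/-- For a closed conformal field `∇̄_{f_*u} X` is a multiple of `f_*u`, so only the normal part of
`∇̄(f_*T)`, which is the second fundamental form, survives. -/
theorem closed_conformal (h : SolitonEquation m d f X T c)
    (hcl : IsClosedField X) (hconf : IsConformalField X)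
    (x : M) (u : TangentSpace (𝓡 m) x) :
    normalConnection m d f (meanCurvature m d f) x u
      + c • secondFundamentalForm m d f x (T x) u = 0 := by
  rw [normalConnection, h.covDerivAlong_meanCurvature,
    leviCivita_of_closed_conformal hcl hconf (h.diff_ambient _), sub_eq_add_neg, ← neg_smul,
        normalPart_add,
    normalPart_smul, normalPart_smul, normalPart_smul, normalPart_mfderiv,
    normalPart_covDerivAlong_mfderiv (h.smooth x) (h.diff_tangent x)]
  simp
end SolitonEquation

end

/-! ### Smoothness of the tangential part of a vector field -/

section

lemma exists_equiv_dual_of_injective {E : Type*} [NormedAddCommGroup E] [NormedSpace ℝ E]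
    [FiniteDimensional ℝ E] (S : E →L[ℝ] E →L[ℝ] ℝ) (hS : Function.Injective S) :
    ∃ e : E ≃L[ℝ] (E →L[ℝ] ℝ), (e : E →L[ℝ] E →L[ℝ] ℝ) = S := by
  have hdim : Module.finrank ℝ E = Module.finrank ℝ (E →L[ℝ] ℝ) := by
    rw [← (LinearMap.toContinuousLinearMap : (E →ₗ[ℝ] ℝ) ≃ₗ[ℝ] (E →L[ℝ] ℝ)).finrank_eq]
    exact Subspace.dual_finrank_eq.symm
  refine ⟨(LinearEquiv.ofInjectiveOfFinrankEq S.toLinearMap hS hdim).toContinuousLinearEquiv, ?_⟩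
  ext v w
  rfl

set_option synthInstance.maxHeartbeats 200000 in
/-- The pull-back of a smooth family of bilinear forms by a smooth family of linear maps is
smooth. -/
lemma contMDiffAt_bilin_comp {H M : Type*} [TopologicalSpace H] {E₀ E F : Type*}
    [NormedAddCommGroup E₀] [NormedSpace ℝ E₀] [NormedAddCommGroup E] [NormedSpace ℝ E]
    [NormedAddCommGroup F] [NormedSpace ℝ F] {I : ModelWithCorners ℝ E₀ H}
    [TopologicalSpace M] [ChartedSpace H M] {n : ℕ∞ω} {G : M → F →L[ℝ] F →L[ℝ] ℝ}
    {A : M → E →L[ℝ] F} {x : M} (hG : ContMDiffAt I 𝓘(ℝ, F →L[ℝ] F →L[ℝ] ℝ) n G x)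
    (hA : ContMDiffAt I 𝓘(ℝ, E →L[ℝ] F) n A x) :
    ContMDiffAt I 𝓘(ℝ, E →L[ℝ] E →L[ℝ] ℝ) n
      (fun y => (ContinuousLinearMap.compL ℝ E F ℝ).flip (A y) ∘L (G y ∘L A y)) x := by
  have h2 : ContMDiffAt I 𝓘(ℝ, (F →L[ℝ] ℝ) →L[ℝ] (E →L[ℝ] ℝ)) n
      (fun y => (ContinuousLinearMap.compL ℝ E F ℝ).flip (A y)) x :=
    ContMDiffAt.comp (g := (ContinuousLinearMap.compL ℝ E F ℝ).flip) (f := A) x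
      (ContinuousLinearMap.contMDiff _).contMDiffAt hA
  exact h2.clm_comp (hG.clm_comp hA)

variable {m : ℕ} {M : Type*} [TopologicalSpace M] [ChartedSpace (EuclideanSpace ℝ (Fin m)) M]
  [IsManifold (𝓡 m) ∞ M]
variable {d : ℕ} {N : Type*} [TopologicalSpace N] [ChartedSpace (EuclideanSpace ℝ (Fin d)) N]
  [IsManifold (𝓡 d) ∞ N]
  [RiemannianBundle (fun q : N => TangentSpace (𝓡 d) q)]
  [IsContMDiffRiemannianBundle (𝓡 d) ∞ (EuclideanSpace ℝ (Fin d))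
      (fun q : N => TangentSpace (𝓡 d) q)]

/-- The metric induced by `f`, in the preferred charts at `x` and `f x`. -/
def inducedCoeff (m d : ℕ) {M N : Type*} [TopologicalSpace M]
    [ChartedSpace (EuclideanSpace ℝ (Fin m)) M] [TopologicalSpace N]
    [ChartedSpace (EuclideanSpace ℝ (Fin d)) N] [IsManifold (𝓡 d) ∞ N]
    [RiemannianBundle (fun q : N => TangentSpace (𝓡 d) q)] (f : M → N) (x y : M) :
    EuclideanSpace ℝ (Fin m) →L[ℝ] EuclideanSpace ℝ (Fin m) →L[ℝ] ℝ :=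
  (ContinuousLinearMap.compL ℝ (EuclideanSpace ℝ (Fin m)) (EuclideanSpace ℝ (Fin d)) ℝ).flip
    (coordDeriv m d f x y) ∘L (metricCoeff d (f x) (f y) ∘L coordDeriv m d f x y)

lemma inducedCoeff_apply (f : M → N) (x y : M) (v w : EuclideanSpace ℝ (Fin m)) :
    inducedCoeff m d f x y v w =
      metricCoeff d (f x) (f y) (coordDeriv m d f x y v) (coordDeriv m d f x y w) := rfl

lemma contMDiffAt_metricCoeff_comp {f : M → N} {x : M} (hf : ContMDiffAt (𝓡 m) (𝓡 d) ∞ f x) :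
    ContMDiffAt (𝓡 m) 𝓘(ℝ, EuclideanSpace ℝ (Fin d) →L[ℝ] EuclideanSpace ℝ (Fin d) →L[ℝ] ℝ) ∞
      (fun y => metricCoeff d (f x) (f y)) x := by
  have h : ContMDiffAt (𝓡 d)
      𝓘(ℝ, EuclideanSpace ℝ (Fin d) →L[ℝ] EuclideanSpace ℝ (Fin d) →L[ℝ] ℝ) ∞
      (metricCoeff d (f x)) (f x) := contMDiffAt_metricCoeff (f x)
  exact ContMDiffAt.comp (g := metricCoeff d (f x)) (f := f) x h hf

lemma contMDiffAt_inducedCoeff {f : M → N} {x : M} (hf : ContMDiffAt (𝓡 m) (𝓡 d) ∞ f x) :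
    ContMDiffAt (𝓡 m) 𝓘(ℝ, EuclideanSpace ℝ (Fin m) →L[ℝ] EuclideanSpace ℝ (Fin m) →L[ℝ] ℝ) ∞
      (inducedCoeff m d f x) x :=
  contMDiffAt_bilin_comp (contMDiffAt_metricCoeff_comp hf) (contMDiffAt_coordDeriv hf)

lemma inducedCoeff_injective {f : M → N} {x y : M}
    (hy : y ∈ (chartAt (EuclideanSpace ℝ (Fin m)) x).source)
    (hfy : f y ∈ (chartAt (EuclideanSpace ℝ (Fin d)) (f x)).source)
    (hcoord : ∀ w : TangentSpace (𝓡 m) y,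
      coords d (f x) (f y) (mfderiv (𝓡 m) (𝓡 d) f y w) = coordDeriv m d f x y (coords m x y w))
    (himm : Function.Injective (mfderiv (𝓡 m) (𝓡 d) f y)) :
    Function.Injective (inducedCoeff m d f x y) := by
  rw [injective_iff_map_eq_zero]
  intro v hv
  have h1 : coords m x y (extendVector (q := x) v y) = v := coords_extendVector _ hy
  have h2 : inducedCoeff m d f x y v v = 0 := by rw [hv]; rfl
  rw [inducedCoeff_apply, ← h1, ← hcoord, ← inner_eq_metricCoeff hfy, inner_self_eq_zero] at h2
  have h3 : extendVector (q := x) v y = 0 := himm (h2.trans (map_zero _).symm)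
  rw [← h1, h3, map_zero]

/-- The tangential part of a smooth ambient field along an immersion is the image of a smooth
vector field. In charts this field is the solution of a linear equation whose matrix, the induced
metric, is smooth and invertible. -/
theorem exists_smooth_tangential_field {f : M → N} (hf : ContMDiff (𝓡 m) (𝓡 d) ∞ f)
    (himm : ∀ x, Function.Injective (mfderiv (𝓡 m) (𝓡 d) f x))
    {X : (q : N) → TangentSpace (𝓡 d) q}
    (hX : ContMDiff (𝓡 d) (𝓡 d).tangent ∞ (fun q => (⟨q, X q⟩ : TangentBundle (𝓡 d) N))) :
    ∃ T : (x : M) → TangentSpace (𝓡 m) x,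
      ContMDiff (𝓡 m) (𝓡 m).tangent ∞ (fun x => (⟨x, T x⟩ : TangentBundle (𝓡 m) M)) ∧
      ∀ x, mfderiv (𝓡 m) (𝓡 d) f x (T x) = tangentialPart m d f x (X (f x)) := by
  have hex : ∀ x, ∃ t : TangentSpace (𝓡 m) x,
      mfderiv (𝓡 m) (𝓡 d) f x t = tangentialPart m d f x (X (f x)) := fun x =>
    Submodule.starProjection_apply_mem (tangentImage m d f x) (X (f x))
  choose T hT using hex
  refine ⟨T, fun x => ?_, hT⟩
  rw [contMDiffAt_section]
  -- `T` solves `g(T, ·) = ⟨X, f_* ·⟩`; the right-hand side `hr` and the inverse `hinv` of `g`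
  -- are smooth
  have hS := contMDiffAt_inducedCoeff (hf x)
  have hXc : ContMDiffAt (𝓡 m) 𝓘(ℝ, EuclideanSpace ℝ (Fin d)) ∞
      (fun y => coords d (f x) (f y) (X (f y))) x :=
    ContMDiffAt.comp x ((contMDiffAt_section (f x)).1 (hX (f x))) (hf x)
  have hr : ContMDiffAt (𝓡 m) 𝓘(ℝ, EuclideanSpace ℝ (Fin m) →L[ℝ] ℝ) ∞ (fun y =>
      (metricCoeff d (f x) (f y) (coords d (f x) (f y) (X (f y)))) ∘L coordDeriv m d f x y) x :=
    ((contMDiffAt_metricCoeff_comp (hf x)).clm_apply hXc).clm_comp (contMDiffAt_coordDeriv (hf x))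
  have hgood : ∀ᶠ y in 𝓝 x, y ∈ (chartAt (EuclideanSpace ℝ (Fin m)) x).source ∧
      f y ∈ (chartAt (EuclideanSpace ℝ (Fin d)) (f x)).source ∧ ∀ w : TangentSpace (𝓡 m) y,
      coords d (f x) (f y) (mfderiv (𝓡 m) (𝓡 d) f y w) = coordDeriv m d f x y (coords m x y w) :=
    (eventually_mem_chart_source (m := m) x).and
      ((eventually_comp_mem_chart_source (d := d) (hf x).continuousAt).and
        (eventually_coords_mfderiv (hf x)))
  have hinj := fun y (hy : _ ∧ _ ∧ _) =>
    inducedCoeff_injective (f := f) (x := x) (y := y) hy.1 hy.2.1 hy.2.2 (himm y)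
  obtain ⟨e, he⟩ := exists_equiv_dual_of_injective _ (hinj x hgood.self_of_nhds)
  have hinv : ContMDiffAt (𝓡 m)
      𝓘(ℝ, (EuclideanSpace ℝ (Fin m) →L[ℝ] ℝ) →L[ℝ] EuclideanSpace ℝ (Fin m)) ∞
      (fun y => (inducedCoeff m d f x y).inverse) x := by
    have h0 : ContDiffAt ℝ ∞ ContinuousLinearMap.inverse (inducedCoeff m d f x x) :=
      he ▸ contDiffAt_map_inverse e
    exact h0.contMDiffAt.comp x hS
  refine (hinv.clm_apply hr).congr_of_eventuallyEq ?_
  filter_upwards [hgood] with y hy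
  obtain ⟨e, he⟩ := exists_equiv_dual_of_injective _ (hinj y hy)
  rw [triv_eq_coords, ← he, ContinuousLinearMap.inverse_equiv]
  refine (e.symm_apply_eq.2 ?_).symm
  refine Eq.trans ?_ (congrArg (fun L => L (coords m x y (T y))) he).symm
  ext v
  have h1 : coords m x y (extendVector (q := x) v y) = v := coords_extendVector _ hy.1
  have h2 := inner_normalPart_mfderiv f y (X (f y)) (extendVector (q := x) v y)
  rw [normalPart, ← hT, inner_sub_left, sub_eq_zero, inner_eq_metricCoeff hy.2.1,
    inner_eq_metricCoeff hy.2.1, hy.2.2, hy.2.2, h1] at h2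
  exact h2

end

/-! ### Hausdorff dimension and local flows in normed spaces -/

section

/-- A map whose strict derivative is injective cannot take values in a set of smaller Hausdorff
dimension: followed by a linear left inverse of its derivative it is locally open. -/
lemma not_injective_of_dimH_lt {W V : Type*} [NormedAddCommGroup W] [NormedSpace ℝ W]
    [FiniteDimensional ℝ W] [NormedAddCommGroup V] [NormedSpace ℝ V] [FiniteDimensional ℝ V]
    {F : W → V} {L : W →L[ℝ] V} {w₀ : W} {S : Set V} (hF : HasStrictFDerivAt F L w₀)
    (hS : ∀ᶠ w in 𝓝 w₀, F w ∈ S) (hdim : dimH S < Module.finrank ℝ W) :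
    ¬ Function.Injective L := by
  intro hL
  obtain ⟨P₀, hP₀⟩ := L.toLinearMap.exists_leftInverse_of_injective (LinearMap.ker_eq_bot.2 hL)
  set P : V →L[ℝ] W := LinearMap.toContinuousLinearMap P₀
  have hPL : P ∘L L = ContinuousLinearMap.id ℝ W := by
    ext w
    exact LinearMap.congr_fun hP₀ w
  have h1 : HasStrictFDerivAt (P ∘ F) (ContinuousLinearMap.id ℝ W) w₀ :=
    hPL ▸ P.hasStrictFDerivAt.comp w₀ hF
  have h2 : P '' S ∈ 𝓝 ((P ∘ F) w₀) := by
    rw [← h1.map_nhds_eq_of_surj (LinearMap.range_eq_top.2 fun w => ⟨w, rfl⟩)]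
    exact Filter.mem_map.2 (hS.mono fun w hw => mem_image_of_mem P hw)
  have h3 := Real.dimH_of_mem_nhds h2
  have h4 : dimH (P '' S) ≤ dimH S := P.lipschitz.dimH_image_le S
  exact absurd (h3 ▸ h4) (not_le.2 hdim)

variable {E : Type*} [NormedAddCommGroup E] [NormedSpace ℝ E] [CompleteSpace E]

/-- A `C¹` vector field has a local flow which is strictly differentiable at time `0`, jointly in
time and initial point. The remainder `φ_t(q) - q - t Y(p)` has a small Lipschitz constant in `t` by
the mean value inequality, because `Y` is continuous, and in `q` because its time derivative
`Y(φ_t(q)) - Y(p)` is Lipschitz in `q` and the time is short. -/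
theorem exists_local_flow_hasStrictFDerivAt {Y : E → E} {p : E} (hY : ContDiffAt ℝ 1 Y p) :
    ∃ φ : ℝ × E → E, ∃ U ∈ 𝓝 p, ∃ ε > (0 : ℝ),
      (∀ q ∈ U, φ (0, q) = q ∧ ∀ t ∈ Ioo (-ε) ε,
        HasDerivAt (fun s => φ (s, q)) (Y (φ (t, q))) t) ∧
      HasStrictFDerivAt φ ((ContinuousLinearMap.fst ℝ ℝ E).smulRight (Y p) +
        ContinuousLinearMap.snd ℝ ℝ E) ((0 : ℝ), p) := by
  obtain ⟨ε, hε, a, r, _, _, hr, hPL⟩ := IsPicardLindelof.of_contDiffAt_one hY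
  obtain ⟨α, hα, L, hL⟩ := (hPL 0).exists_forall_mem_closedBall_eq_hasDerivWithinAt_lipschitzOnWith
  have hder : ∀ q ∈ Metric.closedBall p r, ∀ t ∈ Ioo (-ε) ε,
      HasDerivAt (α q) (Y (α q t)) t := fun q hq t ht =>
    ((hα q hq).2 t (by constructor <;> linarith [ht.1, ht.2])).hasDerivAt
      (Icc_mem_nhds (by linarith [ht.1]) (by linarith [ht.2]))
  have hα0 : ∀ q ∈ Metric.closedBall p r, α q 0 = q := fun q hq => (hα q hq).1
  have hpr : p ∈ Metric.closedBall p r := Metric.mem_closedBall_self r.2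
  refine ⟨fun z => α z.2 z.1, Metric.closedBall p r, Metric.closedBall_mem_nhds p hr, ε, hε,
    fun q hq => ⟨hα0 q hq, hder q hq⟩, ?_⟩
  -- the flow is jointly continuous at `(0, p)`
  have hcont : Filter.Tendsto (fun z : ℝ × E => α z.2 z.1) (𝓝 (0, p)) (𝓝 p) := by
    have h1 : Filter.Tendsto (fun z : ℝ × E => α p z.1) (𝓝 (0, p)) (𝓝 p) := by
      have := (hder p hpr 0 ⟨by linarith, hε⟩).continuousAt
      rw [ContinuousAt, hα0 p hpr] at this
      exact this.comp continuous_fst.continuousAt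
    rw [tendsto_iff_dist_tendsto_zero] at h1 ⊢
    have h2 : Filter.Tendsto (fun z : ℝ × E => L * dist z.2 p + dist (α p z.1) p) (𝓝 (0, p))
        (𝓝 0) := by
      have h3 : Filter.Tendsto (fun z : ℝ × E => (L : ℝ) * dist z.2 p) (𝓝 (0, p))
          (𝓝 (L * dist p p)) :=
        (Continuous.tendsto (by fun_prop) ((0 : ℝ), p))
      simpa using h3.add h1
    refine squeeze_zero' (Filter.Eventually.of_forall fun _ => dist_nonneg) ?_ h2
    have h4 : ∀ᶠ z : ℝ × E in 𝓝 (0, p), z.1 ∈ Ioo (-ε) ε ∧ z.2 ∈ Metric.closedBall p r :=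
      prod_mem_nhds (Ioo_mem_nhds (by linarith) hε) (Metric.closedBall_mem_nhds p hr)
    filter_upwards [h4] with z hz
    refine (dist_triangle _ (α p z.1) _).trans (add_le_add_left ?_ _)
    exact (hL z.1 (by constructor <;> linarith [hz.1.1, hz.1.2])).dist_le_mul _ hz.2 _ hpr
  obtain ⟨K, s, hs, hK⟩ := hY.exists_lipschitzOnWith
  rw [hasStrictFDerivAt_iff_isLittleO, Asymptotics.isLittleO_iff]
  intro c hc
  -- near `(0, p)` the flow stays where `Y` is Lipschitz and `c / 2`-close to `Y p`
  have hnear : ∀ᶠ z : ℝ × E in 𝓝 (0, p), α z.2 z.1 ∈ s ∧ ‖Y (α z.2 z.1) - Y p‖ ≤ c / 2 := by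
    have h1 : Filter.Tendsto (fun q => ‖Y q - Y p‖) (𝓝 p) (𝓝 0) := by
      simpa using (hY.continuousAt.sub (continuousAt_const (y := Y p))).norm.tendsto
    have h2 : ∀ᶠ q in 𝓝 p, ‖Y q - Y p‖ ≤ c / 2 :=
      (h1.eventually_lt_const (by positivity : (0 : ℝ) < c / 2)).mono fun _ h => h.le
    exact (hcont.eventually_mem hs).and (hcont.eventually h2)
  obtain ⟨δ, hδ, hball⟩ := Metric.eventually_nhds_iff_ball.1 hnear
  obtain ⟨η, hη, hηδ, hηε, hηr, hηc⟩ : ∃ η > (0 : ℝ), η ≤ δ ∧ η ≤ ε ∧ η ≤ r ∧ K * L * η ≤ c / 2 := by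
    refine ⟨min (min δ ε) (min r (c / 2 / (K * L + 1))), by positivity, by simp, by simp, by simp,
        ?_⟩
    have h1 : min (min δ ε) (min (r : ℝ) (c / 2 / (K * L + 1))) ≤ c / 2 / (K * L + 1) := by simp
    rw [le_div_iff₀ (by positivity)] at h1
    have h2 : 0 ≤ min (min δ ε) (min (r : ℝ) (c / 2 / (K * L + 1))) := by positivity
    nlinarith
  have hmem : Metric.ball (0 : ℝ) η ×ˢ Metric.ball p η ∈ 𝓝 ((0 : ℝ), p) :=
    prod_mem_nhds (Metric.ball_mem_nhds _ hη) (Metric.ball_mem_nhds _ hη)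
  have hsmall : ∀ t ∈ Metric.ball (0 : ℝ) η, ∀ q ∈ Metric.ball p η,
      α q t ∈ s ∧ ‖Y (α q t) - Y p‖ ≤ c / 2 := fun t ht q hq => by
    refine hball (t, q) ?_
    rw [← ball_prod_same]
    exact ⟨Metric.ball_subset_ball hηδ ht, Metric.ball_subset_ball hηδ hq⟩
  have hIoo : ∀ t ∈ Metric.ball (0 : ℝ) η, t ∈ Ioo (-ε) ε := fun t ht => by
    rw [Metric.mem_ball, Real.dist_0_eq_abs, abs_lt] at ht
    constructor <;> linarith [ht.1, ht.2]
  have hcb : Metric.ball p η ⊆ Metric.closedBall p r :=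
    (Metric.ball_subset_ball hηr).trans Metric.ball_subset_closedBall
  -- the remainder is Lipschitz in time with constant `c / 2`
  have htime : ∀ q ∈ Metric.ball p η, ∀ t ∈ Metric.ball (0 : ℝ) η, ∀ t' ∈ Metric.ball (0 : ℝ) η,
      ‖(α q t - t • Y p) - (α q t' - t' • Y p)‖ ≤ c / 2 * ‖t - t'‖ := fun q hq t ht t' ht' => by
    refine Convex.norm_image_sub_le_of_norm_hasDerivWithin_le (f := fun t => α q t - t • Y p)
      (f' := fun t => Y (α q t) - Y p) (fun u hu => ?_) (fun u hu => (hsmall u hu q hq).2)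
      (convex_ball _ _) ht' ht
    have h1 := (hder q (hcb hq) u (hIoo u hu)).sub ((hasDerivAt_id u).smul_const (Y p))
    rw [one_smul] at h1
    exact h1.hasDerivWithinAt
  -- and in the initial point with constant `K * L * η`
  have hspace : ∀ t ∈ Metric.ball (0 : ℝ) η, ∀ q ∈ Metric.ball p η, ∀ q' ∈ Metric.ball p η,
      ‖(α q t - α q' t) - (q - q')‖ ≤ c / 2 * ‖q - q'‖ := fun t ht q hq q' hq' => by
    have h0 : (0 : ℝ) ∈ Metric.ball (0 : ℝ) η := Metric.mem_ball_self hη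
    have h1 := Convex.norm_image_sub_le_of_norm_hasDerivWithin_le (f := fun t => α q t - α q' t)
      (f' := fun t => Y (α q t) - Y (α q' t)) (C := K * (L * ‖q - q'‖))
      (s := Metric.ball (0 : ℝ) η) (x := 0) (y := t)
      (fun u hu => ((hder q (hcb hq) u (hIoo u hu)).sub
        (hder q' (hcb hq') u (hIoo u hu))).hasDerivWithinAt) (fun u hu => ?_)
      (convex_ball _ _) h0 ht
    · simp only [hα0 q (hcb hq), hα0 q' (hcb hq'), sub_zero] at h1
      have h2 : ‖t‖ ≤ η := by simpa using (mem_ball_zero_iff.1 ht).le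
      calc _ ≤ _ := h1
        _ ≤ K * (L * ‖q - q'‖) * η := by gcongr
        _ = K * L * η * ‖q - q'‖ := by ring
        _ ≤ _ := by gcongr
    · refine (hK.norm_sub_le (hsmall u hu q hq).1 (hsmall u hu q' hq').1).trans ?_
      gcongr
      have hu' := hIoo u hu
      exact (hL u (by constructor <;> linarith [hu'.1, hu'.2])).norm_sub_le (hcb hq) (hcb hq')
  filter_upwards [prod_mem_nhds hmem hmem] with ⟨⟨t, q⟩, ⟨t', q'⟩⟩ ⟨⟨ht, hq⟩, ⟨ht', hq'⟩⟩
  have h1 := htime q hq t ht t' ht'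
  have h2 := hspace t' ht' q hq q' hq'
  have h3 : ‖t - t'‖ ≤ ‖((t, q) : ℝ × E) - (t', q')‖ := norm_fst_le (((t, q) : ℝ × E) - (t', q'))
  have h4 : ‖q - q'‖ ≤ ‖((t, q) : ℝ × E) - (t', q')‖ := norm_snd_le (((t, q) : ℝ × E) - (t', q'))
  have h5 : α q t - α q' t' - ((ContinuousLinearMap.fst ℝ ℝ E).smulRight (Y p) +
        ContinuousLinearMap.snd ℝ ℝ E) (((t, q) : ℝ × E) - (t', q')) =
      ((α q t - t • Y p) - (α q t' - t' • Y p)) + ((α q t' - α q' t') - (q - q')) := by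
    simp [sub_smul]
    abel
  refine (h5 ▸ norm_add_le _ _).trans ?_
  nlinarith

end

/-! ### The flow of a vector field, and the range of a map, in a chart -/

section

/-- Any two points of an open interval lie in a common bounded open subinterval. -/
lemma exists_Ioo_subset_of_ordConnected {K : Set ℝ} (hK : IsOpen K) (hK' : K.OrdConnected)
    {u v : ℝ} (hu : u ∈ K) (hv : v ∈ K) :
    ∃ a b, u ∈ Ioo a b ∧ v ∈ Ioo a b ∧ Ioo a b ⊆ K := by
  have hmin : min u v ∈ K := by rcases min_choice u v with h | h <;> rwa [h]
  have hmax : max u v ∈ K := by rcases max_choice u v with h | h <;> rwa [h]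
  obtain ⟨a, ha, haK⟩ := exists_Ioc_subset_of_mem_nhds (hK.mem_nhds hmin) (exists_lt _)
  obtain ⟨b, hb, hbK⟩ := exists_Ico_subset_of_mem_nhds (hK.mem_nhds hmax) (exists_gt _)
  refine ⟨a, b, ⟨ha.trans_le (min_le_left _ _), (le_max_left _ _).trans_lt hb⟩,
    ⟨ha.trans_le (min_le_right _ _), (le_max_right _ _).trans_lt hb⟩, fun t ht => ?_⟩
  rcases le_total t (min u v) with h | h
  · exact haK ⟨ht.1, h⟩
  rcases le_total t (max u v) with h' | h'
  · exact hK'.out hmin hmax ⟨h, h'⟩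
  · exact hbK ⟨h', ht.2⟩

variable {m : ℕ} {M : Type*} [TopologicalSpace M] [ChartedSpace (EuclideanSpace ℝ (Fin m)) M]
  [IsManifold (𝓡 m) ∞ M]
variable {d : ℕ} {N : Type*} [TopologicalSpace N] [ChartedSpace (EuclideanSpace ℝ (Fin d)) N]
  [IsManifold (𝓡 d) ∞ N]

/-- The components of a vector field in the preferred chart at `p`, as a vector field on the model
space. -/
def chartField (d : ℕ) {N : Type*} [TopologicalSpace N]
    [ChartedSpace (EuclideanSpace ℝ (Fin d)) N] [IsManifold (𝓡 d) ∞ N]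
    (X : (q : N) → TangentSpace (𝓡 d) q) (p : N) (y : EuclideanSpace ℝ (Fin d)) :
    EuclideanSpace ℝ (Fin d) :=
  coords d p ((extChartAt (𝓡 d) p).symm y) (X ((extChartAt (𝓡 d) p).symm y))

lemma chartField_self (X : (q : N) → TangentSpace (𝓡 d) q) (p : N) :
    chartField d X p (extChartAt (𝓡 d) p p) = X p := by
  rw [chartField, extChartAt_to_inv]
  exact coords_self p (X p)

lemma contDiffAt_chartField {X : (q : N) → TangentSpace (𝓡 d) q} {p : N}
    (hX : ContMDiffAt (𝓡 d) (𝓡 d).tangent ∞ (fun q => (⟨q, X q⟩ : TangentBundle (𝓡 d) N)) p) :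
    ContDiffAt ℝ ∞ (chartField d X p) (extChartAt (𝓡 d) p p) := by
  rw [contMDiffAt_section] at hX
  rw [← contMDiffAt_iff_contDiffAt]
  have h1 : ContMDiffAt 𝓘(ℝ, EuclideanSpace ℝ (Fin d)) (𝓡 d) ∞ (extChartAt (𝓡 d) p).symm
      (extChartAt (𝓡 d) p p) :=
    (contMDiffOn_extChartAt_symm p).contMDiffAt (extChartAt_target_mem_nhds p)
  refine ContMDiffAt.comp (g := fun q => coords d p q (X q)) _ ?_ h1
  rw [extChartAt_to_inv]
  exact hX

/-- Integral curves of the components of a vector field in a chart are integral curves. -/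
lemma isMIntegralCurveOn_chart_symm {X : (q : N) → TangentSpace (𝓡 d) q} {p : N}
    {f : ℝ → EuclideanSpace ℝ (Fin d)} {s : Set ℝ}
    (hf : ∀ t ∈ s, HasDerivAt f (chartField d X p (f t)) t)
    (hfs : ∀ t ∈ s, f t ∈ (extChartAt (𝓡 d) p).target) :
    IsMIntegralCurveOn (fun t => (extChartAt (𝓡 d) p).symm (f t)) X s := by
  intro t ht
  have h1 : HasMFDerivAt 𝓘(ℝ, ℝ) 𝓘(ℝ, EuclideanSpace ℝ (Fin d)) f t
      ((1 : ℝ →L[ℝ] ℝ).smulRight (chartField d X p (f t))) := (hf t ht).hasFDerivAt.hasMFDerivAt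
  have h2 : MDifferentiableAt 𝓘(ℝ, EuclideanSpace ℝ (Fin d)) (𝓡 d) (extChartAt (𝓡 d) p).symm
      (f t) := by
    have := mdifferentiableWithinAt_extChartAt_symm (I := 𝓡 d) (hfs t ht)
    rwa [ModelWithCorners.range_eq_univ, mdifferentiableWithinAt_univ] at this
  set q := (extChartAt (𝓡 d) p).symm (f t) with hq
  have hqs : q ∈ (chartAt (EuclideanSpace ℝ (Fin d)) p).source := by
    rw [← extChartAt_source (𝓡 d)]
    exact (extChartAt (𝓡 d) p).map_target (hfs t ht)
  have h3 : mfderiv 𝓘(ℝ, EuclideanSpace ℝ (Fin d)) (𝓡 d) (extChartAt (𝓡 d) p).symm (f t)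
      (chartField d X p (f t)) = X q := by
    apply coords_injective hqs
    rw [coords_eq_mfderiv hqs]
    have h4 := mfderiv_extChartAt_comp_mfderivWithin_extChartAt_symm (I := 𝓡 d) (hfs t ht)
    rw [ModelWithCorners.range_eq_univ, mfderivWithin_univ] at h4
    have h5 := congrArg (fun L => L (chartField d X p (f t))) h4
    refine Eq.trans h5 ?_
    have h6 : chartField d X p (f t) = coords d p q (X q) := rfl
    rw [coords_eq_mfderiv hqs] at h6
    exact h6
  have h5 := HasMFDerivAt.comp t h2.hasMFDerivAt h1
  refine (HasMFDerivAt.congr_mfderiv h5 ?_).hasMFDerivWithinAt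
  ext
  exact (congrArg (mfderiv 𝓘(ℝ, EuclideanSpace ℝ (Fin d)) (𝓡 d) (extChartAt (𝓡 d) p).symm (f t))
    (one_smul ℝ (chartField d X p (f t)))).trans (h3.trans (one_smul ℝ (X q)).symm)

lemma FlowsTo.exists_isMIntegralCurveOn_Ioo {X : (q : N) → TangentSpace (𝓡 d) q} {s : ℝ} {p q : N}
    (h : FlowsTo d X s p q) :
    ∃ (a b : ℝ) (γ : ℝ → N), 0 ∈ Ioo a b ∧ s ∈ Ioo a b ∧ IsMIntegralCurveOn γ X (Ioo a b) ∧
      γ 0 = p ∧ γ s = q := by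
  obtain ⟨K, γ, hK, hK', h0, hs, hγ, hp, hq⟩ := h
  obtain ⟨a, b, h0, hs, hab⟩ := exists_Ioo_subset_of_ordConnected hK hK' h0 hs
  exact ⟨a, b, γ, h0, hs, hγ.mono hab, hp, hq⟩

/-- The point reached by the flow can be computed from any integral curve through the initial
point. -/
lemma FlowsTo.eq_of_isMIntegralCurveOn [T2Space N] {X : (q : N) → TangentSpace (𝓡 d) q}
    (hX : ContMDiff (𝓡 d) (𝓡 d).tangent 1 (fun q => (⟨q, X q⟩ : TangentBundle (𝓡 d) N)))
    {s : ℝ} {p q : N} (h : FlowsTo d X s p q) {a b : ℝ} {γ : ℝ → N} (h0 : 0 ∈ Ioo a b)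
    (hs : s ∈ Ioo a b) (hγ : IsMIntegralCurveOn γ X (Ioo a b)) (hp : γ 0 = p) : γ s = q := by
  obtain ⟨a', b', γ', h0', hs', hγ', hp', hq'⟩ := h.exists_isMIntegralCurveOn_Ioo
  have : IsManifold (𝓡 d) 1 N := .of_le (n := ∞) (by simp)
  rw [← hq']
  exact isMIntegralCurveOn_Ioo_eqOn_of_contMDiff_boundaryless (t₀ := 0)
    (⟨max_lt h0.1 h0'.1, lt_min h0.2 h0'.2⟩ : (0 : ℝ) ∈ Ioo (max a a') (min b b')) hX
    (hγ.mono (Ioo_subset_Ioo (le_max_left _ _) (min_le_left _ _)))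
    (hγ'.mono (Ioo_subset_Ioo (le_max_right _ _) (min_le_right _ _))) (hp.trans hp'.symm)
    ⟨max_lt hs.1 hs'.1, lt_min hs.2 hs'.2⟩

/-- Two points on the same flow line are joined by the flow. -/
lemma FlowsTo.sub [T2Space N] {X : (q : N) → TangentSpace (𝓡 d) q}
    (hX : ContMDiff (𝓡 d) (𝓡 d).tangent 1 (fun q => (⟨q, X q⟩ : TangentBundle (𝓡 d) N)))
    {s s' : ℝ} {p q q' : N} (h : FlowsTo d X s p q) (h' : FlowsTo d X s' p q') :
    FlowsTo d X (s' - s) q q' := by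
  classical
  obtain ⟨a, b, γ, h0, hs, hγ, hp, hq⟩ := h.exists_isMIntegralCurveOn_Ioo
  obtain ⟨a', b', γ', h0', hs', hγ', hp', hq'⟩ := h'.exists_isMIntegralCurveOn_Ioo
  have : IsManifold (𝓡 d) 1 N := .of_le (n := ∞) (by simp)
  have h1 := isMIntegralCurveOn_piecewise hX hγ hγ' ⟨h0, h0'⟩ (hp.trans hp'.symm)
  have h2 := eqOn_piecewise_of_isMIntegralCurveOn_Ioo hX hγ hγ' ⟨h0, h0'⟩ (hp.trans hp'.symm)
  have hK : (Ioo a b ∪ Ioo a' b').OrdConnected :=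
    (isPreconnected_Ioo.union 0 h0 h0' isPreconnected_Ioo).ordConnected
  refine ⟨_, _, (isOpen_Ioo.union isOpen_Ioo).preimage (continuous_add_const s), ?_, ?_, ?_,
    h1.comp_add s, ?_, ?_⟩
  · exact hK.preimage_mono fun x y hxy => add_le_add_left hxy s
  · exact Or.inl (show (0 : ℝ) + s ∈ Ioo a b by rwa [zero_add])
  · exact Or.inr (show s' - s + s ∈ Ioo a' b' by rwa [sub_add_cancel])
  · exact (congrArg _ (zero_add s)).trans ((Set.piecewise_eq_of_mem _ _ _ hs).trans hq)
  · exact (congrArg _ (sub_add_cancel s' s)).trans ((h2 hs').trans hq')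

/-- In a chart, the flow of `X` is represented near `p` by a map which is strictly differentiable
at time `0`. -/
lemma exists_chart_flow [T2Space N] {X : (q : N) → TangentSpace (𝓡 d) q}
    (hX : ContMDiff (𝓡 d) (𝓡 d).tangent ∞ (fun q => (⟨q, X q⟩ : TangentBundle (𝓡 d) N))) (p : N) :
    ∃ φ : ℝ × EuclideanSpace ℝ (Fin d) → EuclideanSpace ℝ (Fin d),
      HasStrictFDerivAt φ ((ContinuousLinearMap.fst ℝ ℝ _).smulRight (X p) +
        ContinuousLinearMap.snd ℝ ℝ _) ((0 : ℝ), extChartAt (𝓡 d) p p) ∧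
      ∀ᶠ z in 𝓝 ((0 : ℝ), p), ∀ q', FlowsTo d X z.1 z.2 q' →
        q' ∈ (extChartAt (𝓡 d) p).source ∧
        φ (z.1, extChartAt (𝓡 d) p z.2) = extChartAt (𝓡 d) p q' := by
  obtain ⟨φ, U, hU, ε, hε, hφ, hstrict⟩ :=
    exists_local_flow_hasStrictFDerivAt ((contDiffAt_chartField (hX p)).of_le (by simp))
  rw [chartField_self] at hstrict
  refine ⟨φ, hstrict, ?_⟩
  have hφ0 : φ (0, extChartAt (𝓡 d) p p) = extChartAt (𝓡 d) p p := (hφ _ (mem_of_mem_nhds hU)).1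
  have h1 : ∀ᶠ z in 𝓝 ((0 : ℝ), extChartAt (𝓡 d) p p), φ z ∈ (extChartAt (𝓡 d) p).target := by
    refine hstrict.continuousAt.eventually_mem ?_
    rw [hφ0]
    exact extChartAt_target_mem_nhds p
  rw [nhds_prod_eq] at h1 ⊢
  obtain ⟨A, hA, B, hB, hAB⟩ := Filter.eventually_prod_iff.1 h1
  obtain ⟨η, hη, hηA⟩ := Metric.eventually_nhds_iff_ball.1 hA
  have hB' : ∀ᶠ q in 𝓝 p, B (extChartAt (𝓡 d) p q) ∧ extChartAt (𝓡 d) p q ∈ U ∧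
      q ∈ (extChartAt (𝓡 d) p).source :=
    ((continuousAt_extChartAt p).eventually hB).and
      (((continuousAt_extChartAt p).eventually_mem hU).and (extChartAt_source_mem_nhds p))
  have hI : ∀ᶠ t in 𝓝 (0 : ℝ), t ∈ Ioo (-(min ε η)) (min ε η) :=
    Ioo_mem_nhds (by simp [hε, hη]) (by simp [hε, hη])
  filter_upwards [hI.prod_mk hB'] with z ⟨hz1, hzB, hzU, hzs⟩ q' hq'
  have h0 : (0 : ℝ) ∈ Ioo (-(min ε η)) (min ε η) := hI.self_of_nhds
  have htgt : ∀ t ∈ Ioo (-(min ε η)) (min ε η),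
      φ (t, extChartAt (𝓡 d) p z.2) ∈ (extChartAt (𝓡 d) p).target := fun t ht => by
    refine hAB (hηA t ?_) hzB
    rw [Real.ball_eq_Ioo, zero_sub, zero_add]
    exact ⟨by linarith [ht.1, min_le_right ε η], ht.2.trans_le (min_le_right _ _)⟩
  have hcurve := isMIntegralCurveOn_chart_symm (X := X) (p := p)
    (f := fun t => φ (t, extChartAt (𝓡 d) p z.2)) (s := Ioo (-(min ε η)) (min ε η))
    (fun t ht => (hφ _ hzU).2 t ⟨by linarith [ht.1, min_le_left ε η],
      ht.2.trans_le (min_le_left _ _)⟩) htgt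
  have h2 := hq'.eq_of_isMIntegralCurveOn (hX.of_le (by simp)) h0 hz1 hcurve (by
    rw [(hφ _ hzU).1, (extChartAt (𝓡 d) p).left_inv hzs])
  rw [← h2]
  exact ⟨(extChartAt (𝓡 d) p).map_target (htgt _ hz1),
    ((extChartAt (𝓡 d) p).right_inv (htgt _ hz1)).symm⟩

/-- The range of a smooth map, seen in a chart, has Hausdorff dimension at most the dimension of
the source. -/
lemma dimH_chart_image_range_le [SecondCountableTopology M] {f : M → N}
    (hf : ContMDiff (𝓡 m) (𝓡 d) ∞ f) (p : N) :
    dimH (extChartAt (𝓡 d) p '' (range f ∩ (extChartAt (𝓡 d) p).source)) ≤ m := by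
  set O : Set M := f ⁻¹' (extChartAt (𝓡 d) p).source with hO
  have hloc : ∀ x ∈ O, ∃ W : Set (EuclideanSpace ℝ (Fin m)), ∃ C,
      W ∈ 𝓝 (extChartAt (𝓡 m) x x) ∧
      LipschitzOnWith C (extChartAt (𝓡 d) p ∘ f ∘ (extChartAt (𝓡 m) x).symm) W := by
    intro x hx
    have h1 : ContMDiffAt 𝓘(ℝ, EuclideanSpace ℝ (Fin m)) (𝓡 m) ∞ (extChartAt (𝓡 m) x).symm
        (extChartAt (𝓡 m) x x) :=
      (contMDiffOn_extChartAt_symm x).contMDiffAt (extChartAt_target_mem_nhds x)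
    have h2 : ContMDiffAt (𝓡 m) 𝓘(ℝ, EuclideanSpace ℝ (Fin d)) ∞ (extChartAt (𝓡 d) p ∘ f) x := by
      refine ContMDiffAt.comp x (contMDiffAt_extChartAt' ?_) (hf x)
      rw [← extChartAt_source (𝓡 d)]
      exact hx
    have h3 : ContMDiffAt 𝓘(ℝ, EuclideanSpace ℝ (Fin m)) 𝓘(ℝ, EuclideanSpace ℝ (Fin d)) ∞
        ((extChartAt (𝓡 d) p ∘ f) ∘ (extChartAt (𝓡 m) x).symm) (extChartAt (𝓡 m) x x) := by
      refine ContMDiffAt.comp _ ?_ h1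
      rwa [extChartAt_to_inv]
    obtain ⟨C, W, hW, hC⟩ := ((contMDiffAt_iff_contDiffAt.1 h3).of_le
      (by simp : (1 : ℕ∞ω) ≤ ∞)).exists_lipschitzOnWith
    exact ⟨W, C, hW, hC⟩
  choose! W C hW hC using hloc
  obtain ⟨t, htO, ht, hcover⟩ := TopologicalSpace.countable_cover_nhdsWithin
    (f := fun x => (extChartAt (𝓡 m) x).source ∩ extChartAt (𝓡 m) x ⁻¹' W x) (s := O)
    (fun x hx => mem_nhdsWithin_of_mem_nhds (Filter.inter_mem (extChartAt_source_mem_nhds x)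
      ((continuousAt_extChartAt x).preimage_mem_nhds (hW x hx))))
  have hsub : extChartAt (𝓡 d) p '' (range f ∩ (extChartAt (𝓡 d) p).source) ⊆
      ⋃ x ∈ t, (extChartAt (𝓡 d) p ∘ f ∘ (extChartAt (𝓡 m) x).symm) '' W x := by
    rintro _ ⟨_, ⟨⟨y, rfl⟩, hy⟩, rfl⟩
    obtain ⟨x, hx, hyx⟩ := mem_iUnion₂.1 (hcover hy)
    refine mem_iUnion₂.2 ⟨x, hx, extChartAt (𝓡 m) x y, hyx.2, ?_⟩
    simp only [Function.comp_apply, (extChartAt (𝓡 m) x).left_inv hyx.1]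
  refine (dimH_mono hsub).trans ?_
  rw [dimH_bUnion ht]
  refine iSup₂_le fun x hx => ((hC x (htO hx)).dimH_image_le).trans ?_
  refine (dimH_mono (subset_univ _)).trans ?_
  rw [Real.dimH_univ_eq_finrank, finrank_euclideanSpace_fin]

end

/-! ### Tangency of families carried by a flow -/

section

/-- Linear algebra behind the tangency theorem: the map
`(s, v) ↦ s (D(1, 0) - c w) + D(0, v)` can only fail to be injective through the first variable if
it is injective in the second. -/
lemma sub_smul_mem_of_not_injective {E F : Type*} [NormedAddCommGroup E] [NormedSpace ℝ E]
    [NormedAddCommGroup F] [NormedSpace ℝ F] {D : ℝ × E →L[ℝ] F} {c : ℝ} {w : F}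
    (hinj : Function.Injective fun v => D (0, v))
    (hnot : ¬ Function.Injective (((ContinuousLinearMap.fst ℝ ℝ F).smulRight w +
      ContinuousLinearMap.snd ℝ ℝ F) ∘L
        (-(ContinuousLinearMap.fst ℝ ℝ E).smulRight c).prod D)) :
    ∃ v, D (0, v) = D (1, 0) - c • w := by
  by_contra! hv
  refine hnot ((injective_iff_map_eq_zero _).2 fun ⟨s, v⟩ hz => ?_)
  have h1 : D (s, v) = s • D (1, 0) + D (0, v) := by
    rw [← map_smul, ← map_add]
    simp
  have h2 : s • (D (1, 0) - c • w) + D (0, v) = 0 := by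
    have h3 : (-(s * c)) • w + D (s, v) = 0 := by simpa using hz
    rw [← h3, h1]
    module
  by_cases hs : s = 0
  · subst hs
    rw [zero_smul, zero_add] at h2
    have h3 : D (0, (0 : E)) = 0 := map_zero D
    exact Prod.ext rfl (hinj (h2.trans h3.symm))
  · refine absurd ?_ (hv (-s⁻¹ • v))
    have h3 : D (0, -s⁻¹ • v) = -s⁻¹ • D (0, v) := by
      rw [← map_smul]
      simp
    rw [h3, eq_neg_of_add_eq_zero_right h2, smul_neg, neg_smul, neg_neg, inv_smul_smul₀ hs]

variable {m : ℕ} {M : Type*} [TopologicalSpace M] [ChartedSpace (EuclideanSpace ℝ (Fin m)) M]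
  [IsManifold (𝓡 m) ∞ M]
variable {d : ℕ} {N : Type*} [TopologicalSpace N] [ChartedSpace (EuclideanSpace ℝ (Fin d)) N]
  [IsManifold (𝓡 d) ∞ N]

section Family

variable {J : Set ℝ} {Ψ : ℝ → M → N} {τ : ℝ}

lemma contMDiff_slice (hJ : IsOpen J)
    (hΨ : ContMDiffOn (𝓘(ℝ, ℝ).prod (𝓡 m)) (𝓡 d) ∞ (fun z : ℝ × M => Ψ z.1 z.2) (J ×ˢ univ))
    (hτ : τ ∈ J) : ContMDiff (𝓡 m) (𝓡 d) ∞ (Ψ τ) := fun x => by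
  have h1 : ContMDiffAt (𝓘(ℝ, ℝ).prod (𝓡 m)) (𝓡 d) ∞ (fun z : ℝ × M => Ψ z.1 z.2) (τ, x) :=
    hΨ.contMDiffAt ((hJ.prod isOpen_univ).mem_nhds ⟨hτ, mem_univ x⟩)
  exact ContMDiffAt.comp (f := fun y => (τ, y)) x h1 (contMDiffAt_const.prodMk contMDiffAt_id)

/-- A family of maps, in the preferred charts at `x` and `Ψ τ x`, is smooth near `(τ, x)`. -/
lemma contDiffAt_family_chart_rep (hJ : IsOpen J)
    (hΨ : ContMDiffOn (𝓘(ℝ, ℝ).prod (𝓡 m)) (𝓡 d) ∞ (fun z : ℝ × M => Ψ z.1 z.2) (J ×ˢ univ))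
    (hτ : τ ∈ J) (x : M) :
    ContDiffAt ℝ ∞ (fun z : ℝ × EuclideanSpace ℝ (Fin m) =>
      extChartAt (𝓡 d) (Ψ τ x) (Ψ z.1 ((extChartAt (𝓡 m) x).symm z.2)))
      (τ, extChartAt (𝓡 m) x x) := by
  have h1 : ContMDiffAt (𝓘(ℝ, ℝ).prod (𝓡 m)) (𝓡 d) ∞ (fun z : ℝ × M => Ψ z.1 z.2) (τ, x) :=
    hΨ.contMDiffAt ((hJ.prod isOpen_univ).mem_nhds ⟨hτ, mem_univ x⟩)
  have h2 : ContMDiffAt 𝓘(ℝ, EuclideanSpace ℝ (Fin m)) (𝓡 m) ∞ (extChartAt (𝓡 m) x).symm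
      (extChartAt (𝓡 m) x x) :=
    (contMDiffOn_extChartAt_symm x).contMDiffAt (extChartAt_target_mem_nhds x)
  have h3 : ContMDiffAt 𝓘(ℝ, ℝ × EuclideanSpace ℝ (Fin m)) (𝓡 m) ∞
      (fun z : ℝ × EuclideanSpace ℝ (Fin m) => (extChartAt (𝓡 m) x).symm z.2)
      (τ, extChartAt (𝓡 m) x x) :=
    ContMDiffAt.comp (f := Prod.snd) _ h2 contDiff_snd.contMDiff.contMDiffAt
  have h4 : ContMDiffAt 𝓘(ℝ, ℝ × EuclideanSpace ℝ (Fin m)) (𝓘(ℝ, ℝ).prod (𝓡 m)) ∞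
      (fun z : ℝ × EuclideanSpace ℝ (Fin m) => (z.1, (extChartAt (𝓡 m) x).symm z.2))
      (τ, extChartAt (𝓡 m) x x) :=
    contDiff_fst.contMDiff.contMDiffAt.prodMk h3
  have h5 : ContMDiffAt (𝓘(ℝ, ℝ).prod (𝓡 m)) 𝓘(ℝ, EuclideanSpace ℝ (Fin d)) ∞
      (fun z : ℝ × M => extChartAt (𝓡 d) (Ψ τ x) (Ψ z.1 z.2)) (τ, x) :=
    ContMDiffAt.comp (f := fun z : ℝ × M => Ψ z.1 z.2) (τ, x) contMDiffAt_extChartAt h1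
  rw [← contMDiffAt_iff_contDiffAt]
  refine ContMDiffAt.comp (g := fun z : ℝ × M => extChartAt (𝓡 d) (Ψ τ x) (Ψ z.1 z.2)) _ ?_ h4
  simpa only [extChartAt_to_inv] using h5

/-- **Tangency.** If near time `τ` the images of `Ψ t` are carried by the flow of `X`, in time
`σ τ - σ t`, into the image of `Ψ τ`, then `∂Ψ/∂τ - σ' X` is tangent to that image. Otherwise the
map `(t, y) ↦ Φ_{σ τ - σ t}(Ψ t y)`, whose derivative at `(τ, x)` is
`(s, v) ↦ s (∂Ψ/∂τ - σ' X) + Ψ_* v`, would be an immersion of an `(m + 1)`-dimensional manifold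
into the image of `Ψ τ`. -/
theorem mfderiv_sub_smul_mem_tangentImage [SecondCountableTopology M] [T2Space N]
    (hJ : IsOpen J)
    (hΨ : ContMDiffOn (𝓘(ℝ, ℝ).prod (𝓡 m)) (𝓡 d) ∞ (fun z : ℝ × M => Ψ z.1 z.2) (J ×ˢ univ))
    (hτ : τ ∈ J) {σ : ℝ → ℝ} (hσ : ContDiffAt ℝ 1 σ τ) {X : (q : N) → TangentSpace (𝓡 d) q}
    (hX : ContMDiff (𝓡 d) (𝓡 d).tangent ∞ (fun q => (⟨q, X q⟩ : TangentBundle (𝓡 d) N)))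
    (hflow : ∀ t ∈ J, ∀ y, ∃ y', FlowsTo d X (σ τ - σ t) (Ψ t y) (Ψ τ y')) (x : M)
    (himm : Function.Injective (mfderiv (𝓡 m) (𝓡 d) (Ψ τ) x)) :
    mfderiv 𝓘(ℝ, ℝ) (𝓡 d) (fun t => Ψ t x) τ (1 : ℝ) - deriv σ τ • X (Ψ τ x) ∈
      tangentImage m d (Ψ τ) x := by
  obtain ⟨φ, hφ, hφflow⟩ := exists_chart_flow hX (Ψ τ x)
  set p := Ψ τ x with hp
  set ξ := extChartAt (𝓡 m) x x with hξ
  set G : ℝ × EuclideanSpace ℝ (Fin m) → EuclideanSpace ℝ (Fin d) := fun z =>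
    extChartAt (𝓡 d) p (Ψ z.1 ((extChartAt (𝓡 m) x).symm z.2)) with hG
  have hGd : ContDiffAt ℝ ∞ G (τ, ξ) := contDiffAt_family_chart_rep hJ hΨ hτ x
  have hGs : HasStrictFDerivAt G (fderiv ℝ G (τ, ξ)) (τ, ξ) := hGd.hasStrictFDerivAt (by simp)
  have hG0 : G (τ, ξ) = extChartAt (𝓡 d) p p := by simp only [hG, hξ, extChartAt_to_inv, hp]
  -- the two partial derivatives of the representation `G` of the family
  have hslice := contMDiff_slice hJ hΨ hτ
  have hG2 : ∀ v : EuclideanSpace ℝ (Fin m),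
      fderiv ℝ G (τ, ξ) (0, v) = mfderiv (𝓡 m) (𝓡 d) (Ψ τ) x v := fun v => by
    have h1 : HasFDerivAt (fun η : EuclideanSpace ℝ (Fin m) => G (τ, η))
        (fderiv ℝ G (τ, ξ) ∘L ContinuousLinearMap.inr ℝ ℝ (EuclideanSpace ℝ (Fin m))) ξ :=
      HasFDerivAt.comp (f := fun η : EuclideanSpace ℝ (Fin m) => (τ, η)) ξ hGs.hasFDerivAt
        (hasFDerivAt_prodMk_right τ ξ)
    have h2 : mfderiv (𝓡 m) (𝓡 d) (Ψ τ) x = fderiv ℝ (fun η => G (τ, η)) ξ := by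
      rw [((hslice x).mdifferentiableAt (by simp)).mfderiv, ModelWithCorners.range_eq_univ,
        fderivWithin_univ]
      rfl
    rw [h2, h1.fderiv]
    rfl
  have hG1 : fderiv ℝ G (τ, ξ) (1, 0) = mfderiv 𝓘(ℝ, ℝ) (𝓡 d) (fun t => Ψ t x) τ (1 : ℝ) := by
    have h1 : HasFDerivAt (fun t : ℝ => G (t, ξ))
        (fderiv ℝ G (τ, ξ) ∘L ContinuousLinearMap.inl ℝ ℝ (EuclideanSpace ℝ (Fin m))) τ :=
      HasFDerivAt.comp (f := fun t : ℝ => (t, ξ)) τ hGs.hasFDerivAt (hasFDerivAt_prodMk_left τ ξ)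
    have h0 : ContMDiffAt 𝓘(ℝ, ℝ) (𝓡 d) ∞ (fun t => Ψ t x) τ :=
      ContMDiffAt.comp (f := fun t : ℝ => (t, x)) (g := fun z : ℝ × M => Ψ z.1 z.2) τ
        (hΨ.contMDiffAt ((hJ.prod isOpen_univ).mem_nhds ⟨hτ, mem_univ x⟩))
        (contMDiffAt_id.prodMk contMDiffAt_const)
    have h2 : mfderiv 𝓘(ℝ, ℝ) (𝓡 d) (fun t => Ψ t x) τ = fderiv ℝ (fun t => G (t, ξ)) τ := by
      have h3 : (fun t => G (t, ξ)) = extChartAt (𝓡 d) p ∘ (fun t => Ψ t x) := by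
        funext t
        simp only [hG, hξ, extChartAt_to_inv, Function.comp_apply]
      rw [(h0.mdifferentiableAt (by simp)).mfderiv, ModelWithCorners.range_eq_univ,
        fderivWithin_univ, h3]
      rfl
    rw [h2, h1.fderiv]
    rfl
  -- the map `(t, y) ↦ Φ_{σ τ - σ t}(Ψ t y)`
  have hσs : HasStrictFDerivAt (fun z : ℝ × EuclideanSpace ℝ (Fin m) => σ τ - σ z.1)
      (-((ContinuousLinearMap.fst ℝ ℝ (EuclideanSpace ℝ (Fin m))).smulRight (deriv σ τ)))
      (τ, ξ) := by
    have h1 : HasStrictFDerivAt σ (ContinuousLinearMap.toSpanSingleton ℝ (deriv σ τ)) τ :=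
      (hσ.hasStrictDerivAt (by simp)).hasStrictFDerivAt
    have h2 := (HasStrictFDerivAt.comp (g := σ) (f := Prod.fst) (τ, ξ) h1
      (hasStrictFDerivAt_fst (𝕜 := ℝ) (p := (τ, ξ)))).const_sub (σ τ)
    exact h2
  have hin : HasStrictFDerivAt (fun z => (σ τ - σ z.1, G z)) _ (τ, ξ) := hσs.prodMk hGs
  have hF := HasStrictFDerivAt.comp (g := φ) (f := fun z => (σ τ - σ z.1, G z)) (τ, ξ)
    (by simpa only [sub_self, hG0] using hφ) hin
  have hS : ∀ᶠ z in 𝓝 (τ, ξ), (φ ∘ fun z => (σ τ - σ z.1, G z)) z ∈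
      extChartAt (𝓡 d) p '' (range (Ψ τ) ∩ (extChartAt (𝓡 d) p).source) := by
    have hc : Filter.Tendsto (fun z : ℝ × EuclideanSpace ℝ (Fin m) =>
        (σ τ - σ z.1, Ψ z.1 ((extChartAt (𝓡 m) x).symm z.2))) (𝓝 (τ, ξ)) (𝓝 (0, p)) := by
      have h1 : ContinuousAt (fun z : ℝ × M => Ψ z.1 z.2) (τ, x) :=
        (hΨ.contMDiffAt ((hJ.prod isOpen_univ).mem_nhds ⟨hτ, mem_univ x⟩)).continuousAt
      have h2 : Filter.Tendsto (fun z : ℝ × EuclideanSpace ℝ (Fin m) =>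
          (z.1, (extChartAt (𝓡 m) x).symm z.2)) (𝓝 (τ, ξ)) (𝓝 (τ, x)) := by
        have h3 := (continuousAt_fst (p := (τ, ξ))).prodMk (ContinuousAt.comp (x := (τ, ξ))
          (f := Prod.snd) (continuousAt_extChartAt_symm (I := 𝓡 m) x) continuousAt_snd)
        simpa only [ContinuousAt, Function.comp_apply, hξ, extChartAt_to_inv] using h3
      have h3 := hσs.continuousAt.tendsto
      rw [sub_self] at h3
      exact h3.prodMk_nhds (h1.tendsto.comp h2)
    have hJ' : ∀ᶠ z : ℝ × EuclideanSpace ℝ (Fin m) in 𝓝 (τ, ξ), z.1 ∈ J :=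
      continuousAt_fst.eventually_mem (hJ.mem_nhds hτ)
    filter_upwards [hc.eventually hφflow, hJ'] with z hz hzJ
    obtain ⟨y', hy'⟩ := hflow z.1 hzJ ((extChartAt (𝓡 m) x).symm z.2)
    obtain ⟨h1, h2⟩ := hz _ hy'
    exact ⟨Ψ τ y', ⟨mem_range_self y', h1⟩, h2.symm⟩
  have hnot := not_injective_of_dimH_lt hF hS (by
    refine (dimH_chart_image_range_le hslice p).trans_lt ?_
    rw [Module.finrank_prod, Module.finrank_self, finrank_euclideanSpace_fin]
    exact_mod_cast (by omega : m < 1 + m))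
  obtain ⟨v, hv⟩ := sub_smul_mem_of_not_injective (D := fderiv ℝ G (τ, ξ)) (c := deriv σ τ)
    (w := X p) (fun v v' h => himm ((hG2 v).symm.trans (h.trans (hG2 v')))) hnot
  exact ⟨v, (hG2 v).symm.trans (hv.trans (congrArg (fun w => w - deriv σ τ • X p) hG1))⟩

end Family
end

/-! ### Self-similar mean curvature flows -/

section

variable {m : ℕ} {M : Type*} [TopologicalSpace M] [ChartedSpace (EuclideanSpace ℝ (Fin m)) M]
  [IsManifold (𝓡 m) ∞ M]
variable {d : ℕ} {N : Type*} [TopologicalSpace N] [ChartedSpace (EuclideanSpace ℝ (Fin d)) N]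
  [IsManifold (𝓡 d) ∞ N]
  [RiemannianBundle (fun q : N => TangentSpace (𝓡 d) q)]

/-- In a self-similar family the flow of `X` carries each image into each other image. -/
lemma IsSelfSimilar.exists_flowsTo [T2Space N]
    [RiemannianBundle (fun x : M => TangentSpace (𝓡 m) x)] {J : Set ℝ} {Ψ : ℝ → M → N}
    {X : (q : N) → TangentSpace (𝓡 d) q}
    (hX : ContMDiff (𝓡 d) (𝓡 d).tangent ∞ (fun q => (⟨q, X q⟩ : TangentBundle (𝓡 d) N)))
    (h : IsSelfSimilar m d J Ψ X) :
    ∃ σ : ℝ → ℝ, ContDiffOn ℝ ∞ σ J ∧ ∀ τ ∈ J, ∀ t ∈ J, ∀ y, ∃ y',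
      FlowsTo d X (σ τ - σ t) (Ψ t y) (Ψ τ y') := by
  obtain ⟨ψ, σ, -, hσ, hJ⟩ := h
  refine ⟨σ, hσ, fun τ hτ t ht y => ?_⟩
  obtain ⟨p, hp, hpt⟩ := ((hJ t ht).2 ▸ mem_range_self y :
    Ψ t y ∈ {q | ∃ p ∈ range ψ, FlowsTo d X (σ t) p q})
  obtain ⟨q, hq⟩ := (hJ τ hτ).1 p hp
  obtain ⟨y', rfl⟩ : q ∈ range (Ψ τ) := (hJ τ hτ).2 ▸ ⟨p, hp, hq⟩
  exact ⟨y', hpt.sub (hX.of_le (by simp)) hq⟩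

/-- If `H - c X` is tangent, then `H` is the normal part of `c X`. -/
lemma smul_eq_add_meanCurvature {f : M → N} {x : M} {c : ℝ} {w : TangentSpace (𝓡 d) (f x)}
    {T : TangentSpace (𝓡 m) x} (hT : mfderiv (𝓡 m) (𝓡 d) f x T = tangentialPart m d f x w)
    (h : meanCurvature m d f x - c • w ∈ tangentImage m d f x) :
    c • w = c • mfderiv (𝓡 m) (𝓡 d) f x T + meanCurvature m d f x := by
  obtain ⟨v, hv⟩ := h
  have h1 : meanCurvature m d f x = c • w + mfderiv (𝓡 m) (𝓡 d) f x v := by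
    rw [add_comm]
    exact sub_eq_iff_eq_add.1 hv.symm
  have h2 : meanCurvature m d f x = c • normalPart m d f x w := by
    rw [← normalPart_meanCurvature f x, h1, normalPart_add, normalPart_smul, normalPart_mfderiv,
      add_zero]
  rw [hT, h2, normalPart, ← smul_add, add_sub_cancel]

end

end MCFSoliton

end

theorem proposition2p1 {m n : ℕ}
    {M : Type*} [TopologicalSpace M] [T2Space M] [SecondCountableTopology M]
    [ChartedSpace (EuclideanSpace ℝ (Fin m)) M] [IsManifold (𝓡 m) ∞ M]
    [RiemannianBundle (fun x : M => TangentSpace (𝓡 m) x)]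
    [IsContMDiffRiemannianBundle (𝓡 m) ∞ (EuclideanSpace ℝ (Fin m))
      (fun x : M => TangentSpace (𝓡 m) x)]
    {N : Type*} [TopologicalSpace N] [T2Space N] [SecondCountableTopology N]
    [ChartedSpace (EuclideanSpace ℝ (Fin (n + 1))) N] [IsManifold (𝓡 (n + 1)) ∞ N]
    [RiemannianBundle (fun q : N => TangentSpace (𝓡 (n + 1)) q)]
    [IsContMDiffRiemannianBundle (𝓡 (n + 1)) ∞ (EuclideanSpace ℝ (Fin (n + 1)))
      (fun q : N => TangentSpace (𝓡 (n + 1)) q)]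
    (J : Set ℝ) (hJ_open : IsOpen J) (hJ_conn : J.OrdConnected) (hJ_zero : 0 ∈ J)
    (X : (q : N) → TangentSpace (𝓡 (n + 1)) q)
    (hX : ContMDiff (𝓡 (n + 1)) (𝓡 (n + 1)).tangent ∞
      (fun q => (⟨q, X q⟩ : TangentBundle (𝓡 (n + 1)) N)))
    (Ψ : ℝ → M → N)
    (hΨ : MCFSoliton.IsMeanCurvatureFlow m (n + 1) J Ψ)
    (hself : MCFSoliton.IsSelfSimilar m (n + 1) J Ψ X) :
    ∀ τ ∈ J, ∃ (c : ℝ) (T : (x : M) → TangentSpace (𝓡 m) x),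
      ContMDiff (𝓡 m) (𝓡 m).tangent ∞ (fun x => (⟨x, T x⟩ : TangentBundle (𝓡 m) M)) ∧
      (∀ x, mfderiv (𝓡 m) (𝓡 (n + 1)) (Ψ τ) x (T x) =
        MCFSoliton.tangentialPart m (n + 1) (Ψ τ) x (X (Ψ τ x))) ∧
      (∀ x, c • X (Ψ τ x) =
        c • mfderiv (𝓡 m) (𝓡 (n + 1)) (Ψ τ) x (T x) + MCFSoliton.meanCurvature m (n + 1) (Ψ τ) x) ∧
      (MCFSoliton.IsClosedField X → MCFSoliton.IsConformalField X →
        ∀ (x : M) (u : TangentSpace (𝓡 m) x),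
          MCFSoliton.normalConnection m (n + 1) (Ψ τ) (MCFSoliton.meanCurvature m (n + 1) (Ψ τ)) x u
            + c • MCFSoliton.secondFundamentalForm m (n + 1) (Ψ τ) x (T x) u = 0) ∧
      (MCFSoliton.IsConformalField X →
        ∀ (x : M) (u v : TangentSpace (𝓡 m) x),
          MCFSoliton.secondFundamentalFormDir m (n + 1) (Ψ τ) x (-MCFSoliton.meanCurvature m (n + 1) (Ψ τ) x) u v
            + c / 2 * MCFSoliton.lieDerivTensor (MCFSoliton.inducedMetric m (n + 1) (Ψ τ)) T x u v
          = c * MCFSoliton.conformalFactor X (Ψ τ x) * MCFSoliton.inducedMetric m (n + 1) (Ψ τ) x u v) := by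
  intro τ hτ
  obtain ⟨σ, hσ, hflow⟩ := hself.exists_flowsTo hX
  have hσ' : ContDiffAt ℝ 1 σ τ := (hσ.contDiffAt (hJ_open.mem_nhds hτ)).of_le (by simp)
  have hsmooth := MCFSoliton.contMDiff_slice hJ_open hΨ.smooth hτ
  obtain ⟨T, hT, hT'⟩ :=
    MCFSoliton.exists_smooth_tangential_field hsmooth (hΨ.immersion τ hτ) hX
  have heq : ∀ x, deriv σ τ • X (Ψ τ x) =
      deriv σ τ • mfderiv (𝓡 m) (𝓡 (n + 1)) (Ψ τ) x (T x) +
        MCFSoliton.meanCurvature m (n + 1) (Ψ τ) x := fun x => by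
    refine MCFSoliton.smul_eq_add_meanCurvature (hT' x) ?_
    rw [← hΨ.evolution τ hτ x]
    exact MCFSoliton.mfderiv_sub_smul_mem_tangentImage hJ_open hΨ.smooth hτ hσ' hX
      (fun t ht y => hflow τ hτ t ht y) x (hΨ.immersion τ hτ x)
  have hsol : MCFSoliton.SolitonEquation m (n + 1) (Ψ τ) X T (deriv σ τ) :=
    ⟨hsmooth, fun q => MCFSoliton.differentiableField_of_contMDiff (hX q),
      fun x => MCFSoliton.differentiableField_of_contMDiff (hT x), heq⟩
  exact ⟨deriv σ τ, T, hT, hT', heq, hsol.closed_conformal, hsol.conformal⟩
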